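/- **Conventions.** A compact pair $(X,A)$ is a compact Hausdorff space $X$ with a closed subspace $A$; $(X,A)\times(Y,B)=(X\times Y,\,A\times Y\cup X\times B)$. Pointed spaces are compactly generated, and smash products are formed in compactly generated spaces. $K^+$ is $K$ with a disjoint base point, $I=[0,1]$. Let $|X|$ be the geometric realization of the singular complex of $X$ and $L(X,A)=|X|/|A|$, with the natural pairing $\omega_L:L(X,A)\wedge L(Y,B)\to L((X,A)\times(Y,B))$. A *multiplicative functor* $(F,\omega_F)$ is a functor $F$ from compact pairs to pointed spaces with a natural transformation $\omega_F:F(X,A)\wedge L(Y,B)\to F((X,A)\times(Y,B))$ which is unital ($F(X,A)=F(X,A)\wedge \{v\}^+\to F(X,A)\wedge L(*)\to F((X,A)\times *)=F(X,A)$ is the identity, $v$ the vertex of $|*|$) and associative with respect to $\omega_L$; $L$ itself is one. For a homotopy $H:(X,A)\times I\to (Y,B)$ let $\widehat F(H):F(X,A)\wedge I^+\to F(Y,B)$ be $$F(X,A)\wedge I^+\xrightarrow{1\wedge\iota}F(X,A)\wedge L(I)\xrightarrow{\omega_F}F((X,A)\times I)\xrightarrow{F(H)}F(Y,B),$$ where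 $\iota:I^+\to L(I)$ is given by the singular simplex $\Delta_1= I$. It is a path of pointed maps from $F(H_0)$ to $F(H_1)$. **Bundles.** Let $\mathcal C$ be the category of fiberwise smooth bundles $E\downarrow(B,A)$: bundles $E\to B$ over a compact pair $(B,A)$ whose fibers are compact smooth manifolds, possibly with boundary, with coordinate changes that are families of diffeomorphisms continuous in the $C^\infty$ topology. The arrows $(\tilde f,f):E\downarrow(B,A)\to E'\downarrow(B',A')$ are the fiberwise smooth bundle maps which are diffeomorphisms on each fiber and cover a map of pairs $f:(B,A)\to(B',A')$. Put $L(E\downarrow(B,A))=L(B,A)$ and $F(E\downarrow(B,A))=F(E,E|_A)$, and $(E\downarrow(B,A))\times(X,Y)=E\times X\downarrow(B,A)\times(X,Y)$. **Transfer.** Let $T:L\to F$ be a simplicial transformation on the nerve of $\mathcal C$: to each $p$-simplex $\sigma=(E_0\to\cdots\to E_p)$ over $(B_0,A_0)\to\cdots\to(B_p,A_p)$ it assigns a pointed map $T(\sigma):L(B_0,A_0)\wedge\Delta_p^+\to F(E_p,E_p|_{A_p})$, such that for each order preserving $\alpha:[q]\to[p]$ $$T(\sigma)(1\wedge\alpha)=F(E_{\alpha(q)}\to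 E_p)\;T(\alpha^*\sigma)\;\bigl(L(E_0\to E_{\alpha(0)})\wedge 1\bigr).$$ So each bundle $E\downarrow(B,A)$ has a map $T(E):L(B,A)\to F(E,E|_A)$, and each arrow $(\tilde f,f):E\to E'$ a path of pointed maps $T(\tilde f,f):F(\tilde f)T(E)\sim T(E')L(f)$ (with $\Delta_1=I$). Suppose that $T$ is multiplicative in the following sense: there is a simplicial homotopy $\mu$ on the nerve of $\mathcal C\times\{\text{compact pairs}\}$, that is, a simplicial transformation from $(E\downarrow(B,A),(X,Y))\mapsto L(B,A)\wedge L(X,Y)\wedge I^+$ to $(E\downarrow (B,A),(X,Y))\mapsto F(E\times(X,Y))$, which is $\omega_F(T\wedge 1)$ at $0\in I$ and $(\sigma,\xi)\mapsto T(\sigma\times\xi)(\omega_L\wedge 1)$ at $1\in I$, and which is constant in the parameter of $I$ on simplices whose second components are all one point spaces $(*,\emptyset)$. Every refined transfer for a homology theory $F$, restricted to the bundles $E=(\emptyset<E)$, is a $T$ of this kind. **Theorem (7.5).** Let $E\downarrow(B,A)$ and $E'\downarrow(B',A')$ be fiberwise smooth bundles and $(\tilde H,H):E\times I\downarrow(B\times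 I,A\times I)\to E'\downarrow(B',A')$ an arrow of $\mathcal C$. Let $(\tilde i_j,i_j):E\to E\times I$ be the inclusion at $j\in\{0,1\}$ and $(\tilde h_j,h_j)=(\tilde H\tilde i_j,Hi_j)$. Then the square of paths of pointed maps $L(B,A)\to F(E',E'|_{A'})$ $$\begin{array}{ccc} T(E')L(h_0) & \xrightarrow{\;T(E')\widehat L(H)\;} & T(E')L(h_1)\\ {\scriptstyle T(\tilde h_0,h_0)}\big\uparrow & & \big\uparrow{\scriptstyle T(\tilde h_1,h_1)}\\ F(\tilde h_0)T(E) & \xrightarrow{\;\widehat F(\tilde H)(T(E)\wedge 1)\;} & F(\tilde h_1)T(E) \end{array}$$ commutes as a square of path classes: the two composite paths from $F(\tilde h_0)T(E)$ to $T(E')L(h_1)$ are homotopic relative to their end points, through pointed maps. -/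

import Mathlib

open CategoryTheory Topology Set Opposite

/-! ### Geometric realization in terms of cells -/
namespace RefinedTransfer
section
open Simplicial

/-- The point of `|S|` with coordinates `w` in the closed cell of the simplex `s`. -/
noncomputable def cell (S : SSet.{0}) {n : ℕ} (s : S _⦋n⦌) (w : stdSimplex ℝ (Fin (n + 1))) :
    SSet.toTop.obj S :=
  SSet.toTop.map (SSet.yonedaEquiv.symm s) ((SimplexCategory.toTopHomeo ⦋n⦌).symm w)

theorem continuous_cell (S : SSet.{0}) {n : ℕ} (s : S _⦋n⦌) : Continuous (cell S s) :=
  (SSet.toTop.map (SSet.yonedaEquiv.symm s)).hom.continuous.comp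
    (SimplexCategory.toTopHomeo ⦋n⦌).symm.continuous

theorem cell_map (S : SSet.{0}) {m n : ℕ} (s : S _⦋n⦌) (f : ⦋m⦌ ⟶ ⦋n⦌)
    (w : stdSimplex ℝ (Fin (m + 1))) :
    cell S (S.map f.op s) w = cell S s (stdSimplex.map f w) := by
  unfold cell
  have h := SimplexCategory.toTopHomeo_symm_naturality_apply f w
  erw [h]
  rw [← SSet.yonedaEquiv_symm_naturality_left]
  simp

theorem map_cell {S T : SSet.{0}} (f : S ⟶ T) {n : ℕ} (s : S _⦋n⦌)
    (w : stdSimplex ℝ (Fin (n + 1))) :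
    SSet.toTop.map f (cell S s w) = cell T (f.app _ s) w := by
  unfold cell
  rw [← SSet.yonedaEquiv_symm_comp, Functor.map_comp]
  rfl

theorem homEquiv_app (S : SSet.{0}) (W : TopCat.{0}) (f : SSet.toTop.obj S ⟶ W) {n : ℕ}
    (s : S _⦋n⦌) (w : stdSimplex ℝ (Fin (n + 1))) :
    TopCat.toSSetObjEquiv W _ ((sSetTopAdj.homEquiv S W f).app (op ⦋n⦌) s) w =
      f (cell S s w) := by
  rw [Adjunction.homEquiv_unit]
  have h := sSetTopAdj_unit_app_app_down S (op ⦋n⦌) s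
  change (TopCat.Hom.hom (((sSetTopAdj.unit.app S).app (op ⦋n⦌) s).down ≫ f)) (ULift.up w) = _
  rw [h]
  rfl

theorem realization_hom_ext {S : SSet.{0}} {W : Type} [TopologicalSpace W]
    {f g : SSet.toTop.obj S → W} (hf : Continuous f) (hg : Continuous g)
    (h : ∀ (n : ℕ) (s : S _⦋n⦌) w, f (cell S s w) = g (cell S s w)) : f = g := by
  have : TopCat.ofHom ⟨f, hf⟩ = TopCat.ofHom (Y := W) ⟨g, hg⟩ := by
    apply (sSetTopAdj.homEquiv S (TopCat.of W)).injective
    ext ⟨⟨n⟩⟩ s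
    apply (TopCat.toSSetObjEquiv (TopCat.of W) _).injective
    ext w
    erw [homEquiv_app, homEquiv_app]
    exact h _ s w
  have h2 := congrArg (fun k => (TopCat.Hom.hom k : SSet.toTop.obj S → W)) this
  exact h2

theorem exists_cell {S : SSet.{0}} (x : SSet.toTop.obj S) :
    ∃ (n : ℕ) (s : S _⦋n⦌) (w : stdSimplex ℝ (Fin (n + 1))), cell S s w = x := by
  let _ : TopologicalSpace Prop := ⊤
  have := realization_hom_ext (W := Prop) (S := S)
    (f := fun x => ∃ (n : ℕ) (s : S _⦋n⦌) (w : stdSimplex ℝ (Fin (n + 1))), cell S s w = x)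
    (g := fun _ => True) continuous_top continuous_top
    (fun n s w => by simp only [eq_iff_iff, iff_true]; exact ⟨n, s, w, rfl⟩)
  have h := congrFun this x
  simpa using h

theorem exists_desc (S : SSet.{0}) {W : Type} [TopologicalSpace W]
    (φ : ∀ n : ℕ, S _⦋n⦌ → C(stdSimplex ℝ (Fin (n + 1)), W))
    (hφ : ∀ (m n : ℕ) (f : ⦋m⦌ ⟶ ⦋n⦌) (s : S _⦋n⦌) w,
      φ m (S.map f.op s) w = φ n s (stdSimplex.map f w)) :
    ∃ F : C(SSet.toTop.obj S, W), ∀ (n : ℕ) (s : S _⦋n⦌) w, F (cell S s w) = φ n s w := by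
  let ψ : S ⟶ TopCat.toSSet.obj (TopCat.of W) :=
    { app := fun n => TypeCat.ofHom fun s => (TopCat.toSSetObjEquiv (TopCat.of W) n).symm (φ n.unop.len s)
      naturality := by
        rintro ⟨⟨n⟩⟩ ⟨⟨m⟩⟩ ⟨f⟩
        ext s
        apply (TopCat.toSSetObjEquiv (TopCat.of W) _).injective
        ext w
        exact hφ m n f s w }
  refine ⟨((sSetTopAdj.homEquiv S (TopCat.of W)).symm ψ).hom, fun n s w => ?_⟩
  have := homEquiv_app S (TopCat.of W) ((sSetTopAdj.homEquiv S (TopCat.of W)).symm ψ) s w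
  rw [Equiv.apply_symm_apply] at this
  rw [← this]
  simp [ψ]

theorem continuous_realization_iff {S : SSet.{0}} {W : Type} [TopologicalSpace W]
    (f : SSet.toTop.obj S → W)
    (hf : ∀ (n : ℕ) (s : S _⦋n⦌), Continuous fun w => f (cell S s w)) : Continuous f := by
  obtain ⟨F, hF⟩ := exists_desc S (fun n s => ⟨_, hf n s⟩) (fun m n g s w => by
    simp [cell_map])
  have : f = F := by
    ext x
    obtain ⟨n, s, w, rfl⟩ := exists_cell x
    exact (hF n s w).symm
  rw [this]
  exact F.continuous

instance (S : SSet.{0}) : CompactlyGeneratedSpace (SSet.toTop.obj S) := by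
  apply compactlyGeneratedSpace_of_continuous_maps
  intro Y _ f h
  exact continuous_realization_iff f fun n s => h _ _ (continuous_cell S s)

end
end RefinedTransfer
/-! ### Subdividing the simplex -/
namespace RefinedTransfer
open Finset in
theorem simplexMap_apply {m n : ℕ} (f : Fin (m + 1) → Fin (n + 1))
    (w : stdSimplex ℝ (Fin (m + 1))) (i : Fin (n + 1)) :
    stdSimplex.map f w i = ∑ k with f k = i, w k := by
  simp [FunOnFinite.linearMap_apply_apply]

open Finset in
theorem simplexMap_cum {m n : ℕ} (f : Fin (m + 1) → Fin (n + 1))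
    (w : stdSimplex ℝ (Fin (m + 1))) (i : Fin (n + 1)) :
    ∑ j ∈ Finset.Iic i, stdSimplex.map f w j = ∑ k with f k ≤ i, w k := by
  simp only [simplexMap_apply]
  rw [← Finset.sum_biUnion]
  · congr 1
    ext k
    simp
  · intro a _ b _ hab
    simp only [Function.onFun, Finset.disjoint_left, Finset.mem_filter, Finset.mem_univ, true_and]
    rintro k rfl h
    exact hab h

theorem eq_of_cum {n : ℕ} (u v : stdSimplex ℝ (Fin (n + 1)))
    (h : ∀ i, ∑ j ∈ Finset.Iic i, u j = ∑ j ∈ Finset.Iic i, v j) : u = v := by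
  ext i
  induction i using WellFoundedLT.induction with
  | _ i ih =>
    have := h i
    rw [← Finset.Iio_insert, Finset.sum_insert (by simp), Finset.sum_insert (by simp),
      Finset.sum_congr rfl (fun j hj => ih j (Finset.mem_Iio.1 hj))] at this
    linarith

theorem eq_of_simplexMap_eq {m n : ℕ} {w : stdSimplex ℝ (Fin (m + 1))} (hw : ∀ k, 0 < w k)
    {f g : Fin (m + 1) →o Fin (n + 1)} (h : stdSimplex.map f w = stdSimplex.map g w) : f = g := by
  have key : ∀ (f g : Fin (m + 1) →o Fin (n + 1)),
      stdSimplex.map f w = stdSimplex.map g w → ∀ k, g k ≤ f k := by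
    intro f g h k
    by_contra hlt
    push Not at hlt
    have hc := simplexMap_cum f w (f k)
    rw [h, simplexMap_cum] at hc
    refine absurd hc (ne_of_lt ?_)
    apply Finset.sum_lt_sum_of_subset (i := k)
    · intro l hl
      simp only [Finset.mem_filter, Finset.mem_univ, true_and] at hl ⊢
      apply f.monotone
      by_contra hkl
      push Not at hkl
      exact absurd (g.monotone hkl.le) (not_le.2 (lt_of_le_of_lt hl hlt))
    · simp
    · simpa using hlt
    · exact hw k
    · intro j _ _
      exact (hw j).le
  ext k
  exact congrArg _ (le_antisymm (key g f h.symm k) (key f g h k))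

/-- Two points of simplices are images of one interior point of a common subdivision. -/
theorem exists_common_subdivision {m n : ℕ} (u : stdSimplex ℝ (Fin (m + 1)))
    (v : stdSimplex ℝ (Fin (n + 1))) :
    ∃ (q : ℕ) (_ : q < m + n + 2) (z : stdSimplex ℝ (Fin (q + 1)))
      (f : Fin (q + 1) →o Fin (m + 1)) (g : Fin (q + 1) →o Fin (n + 1)),
      (∀ k, 0 < z k) ∧ stdSimplex.map f z = u ∧ stdSimplex.map g z = v := by
  classical
  let U : ∀ {r : ℕ} (_ : stdSimplex ℝ (Fin (r + 1))), Fin (r + 1) → ℝ :=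
    fun w i => ∑ j ∈ Finset.Iic i, w j
  have Ulast : ∀ {r : ℕ} (w : stdSimplex ℝ (Fin (r + 1))), U w (Fin.last r) = 1 := by
    intro r w
    have : Finset.Iic (Fin.last r) = Finset.univ := by
      ext i; simp [Fin.le_last]
    simp [U, this]
  have Umono : ∀ {r : ℕ} (w : stdSimplex ℝ (Fin (r + 1))), Monotone (U w) := by
    intro r w i j hij
    exact Finset.sum_le_sum_of_subset_of_nonneg (Finset.Iic_subset_Iic.2 hij) (by simp)
  have Unn : ∀ {r : ℕ} (w : stdSimplex ℝ (Fin (r + 1))) i, 0 ≤ U w i := by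
    intro r w i
    exact Finset.sum_nonneg (by simp)
  let F : Finset ℝ := ((Finset.univ.image (U u)) ∪ (Finset.univ.image (U v))).filter (0 < ·)
  have hF1 : (1 : ℝ) ∈ F := by
    simp only [F, Finset.mem_filter, Finset.mem_union, Finset.mem_image, Finset.mem_univ, true_and,
      zero_lt_one, and_true]
    exact Or.inl ⟨_, Ulast u⟩
  have hFle : ∀ x ∈ F, x ≤ 1 := by
    intro x hx
    simp only [F, Finset.mem_filter, Finset.mem_union, Finset.mem_image, Finset.mem_univ,
      true_and] at hx
    rcases hx with ⟨⟨i, rfl⟩ | ⟨i, rfl⟩, -⟩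
    · rw [← Ulast u]; exact Umono u (Fin.le_last i)
    · rw [← Ulast v]; exact Umono v (Fin.le_last i)
  have hFpos : ∀ x ∈ F, 0 < x := fun x hx => (Finset.mem_filter.1 hx).2
  have hcard : F.card ≤ (m + 1) + (n + 1) := by
    refine (Finset.card_filter_le _ _).trans ((Finset.card_union_le _ _).trans ?_)
    gcongr
    · exact Finset.card_image_le.trans (by simp)
    · exact Finset.card_image_le.trans (by simp)
  obtain ⟨q, hq⟩ : ∃ q, F.card = q + 1 :=
    Nat.exists_eq_succ_of_ne_zero (Finset.card_ne_zero.2 ⟨1, hF1⟩)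
  let c := F.orderEmbOfFin hq
  have hc : ∀ k, c k ∈ F := F.orderEmbOfFin_mem hq
  have hcsurj : ∀ x ∈ F, ∃ k, c k = x := by
    intro x hx
    have : x ∈ Set.range c := by rw [Finset.range_orderEmbOfFin]; exact hx
    exact this
  -- the extended sequence of break points
  let d : ℕ → ℝ := fun k => if h : 0 < k ∧ k - 1 < q + 1 then c ⟨k - 1, h.2⟩ else 0
  have hd0 : d 0 = 0 := by simp [d]
  have hd : ∀ k : Fin (q + 1), d (k + 1) = c k := by
    intro k
    have := k.2
    simp only [d, Nat.succ_pos, Nat.add_sub_cancel, this, and_self, dite_true]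
  have hdpos : ∀ k : Fin (q + 1), 0 < d (k + 1) - d k := by
    intro k
    rw [hd]
    rcases k with ⟨_ | k, hk⟩
    · simp only [hd0, sub_zero]; exact hFpos _ (hc _)
    · have : d (k + 1) = c ⟨k, by omega⟩ := hd ⟨k, by omega⟩
      simp only [this, sub_pos]
      exact c.strictMono (by simp [Fin.lt_def])
  have htel : ∀ k : Fin (q + 1), ∑ j ∈ Finset.Iic k, (d (j + 1) - d j) = c k := by
    intro k
    have : ∑ j ∈ Finset.Iic k, (d (j + 1) - d j) =
        ∑ j ∈ Finset.range (k + 1), (d (j + 1) - d j) := by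
      refine Finset.sum_bij (fun j _ => (j : ℕ)) ?_ ?_ ?_ ?_
      · intro a ha; simp only [Finset.mem_Iic, Fin.le_def] at ha; simp; omega
      · intro a _ b _ h; exact Fin.ext h
      · intro b hb
        simp only [Finset.mem_range] at hb
        exact ⟨⟨b, by omega⟩, by simp [Fin.le_def]; omega, rfl⟩
      · intro a _; rfl
    rw [this, Finset.sum_range_sub, hd0, hd, sub_zero]
  have hclast : c (Fin.last q) = 1 := by
    obtain ⟨k, hk⟩ := hcsurj 1 hF1
    apply le_antisymm (hFle _ (hc _))
    rw [← hk]
    exact c.monotone (Fin.le_last k)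
  let z : stdSimplex ℝ (Fin (q + 1)) := ⟨fun k => d (k + 1) - d k, fun k => (hdpos k).le, by
    have := htel (Fin.last q)
    have h2 : Finset.Iic (Fin.last q) = Finset.univ := by
      ext i; simp [Fin.le_last]
    rwa [h2, hclast] at this⟩
  have hz : ∀ k, z k = d (k + 1) - d k := fun k => rfl
  have main : ∀ {r : ℕ} (w : stdSimplex ℝ (Fin (r + 1))), (∀ i, 0 < U w i → U w i ∈ F) →
      ∃ f : Fin (q + 1) →o Fin (r + 1), stdSimplex.map f z = w := by
    intro r w hw
    have hex : ∀ k, (Finset.univ.filter (fun i => c k ≤ U w i)).Nonempty := fun k =>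
      ⟨Fin.last r, by simp [Ulast, hFle _ (hc k)]⟩
    let f : Fin (q + 1) → Fin (r + 1) := fun k => Finset.min' _ (hex k)
    have hf : ∀ k i, f k ≤ i ↔ c k ≤ U w i := by
      intro k i
      constructor
      · intro h
        have := Finset.min'_mem _ (hex k)
        simp only [Finset.mem_filter, Finset.mem_univ, true_and] at this
        exact this.trans (Umono w h)
      · intro h
        exact Finset.min'_le _ _ (by simpa using h)
    refine ⟨⟨f, fun a b hab => (hf _ _).2 ((c.monotone hab).trans ((hf b _).1 le_rfl))⟩, ?_⟩
    apply eq_of_cum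
    intro i
    rw [simplexMap_cum]
    change ∑ k with f k ≤ i, z k = U w i
    simp only [hf, hz]
    rcases (Unn w i).eq_or_lt with h0 | hpos
    · rw [← h0]
      apply Finset.sum_eq_zero
      intro k hk
      simp only [Finset.mem_filter] at hk
      exact absurd hk.2 (not_le.2 (hFpos _ (hc k)))
    · obtain ⟨k, hk⟩ := hcsurj _ (hw i hpos)
      rw [← hk]
      refine Eq.trans ?_ (htel k)
      congr 1
      ext j
      simp
  obtain ⟨f, hf⟩ := main u (fun i hi => by
    simp only [F, Finset.mem_filter, Finset.mem_union, Finset.mem_image, Finset.mem_univ, true_and]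
    exact ⟨Or.inl ⟨i, rfl⟩, hi⟩)
  obtain ⟨g, hg⟩ := main v (fun i hi => by
    simp only [F, Finset.mem_filter, Finset.mem_union, Finset.mem_image, Finset.mem_univ, true_and]
    exact ⟨Or.inr ⟨i, rfl⟩, hi⟩)
  exact ⟨q, by omega, z, f, g, fun k => hdpos k, hf, hg⟩
end RefinedTransfer
/-! ### Realization of products of singular complexes -/
namespace RefinedTransfer
/-- `|X|`, the geometric realization of the singular complex of a space `X`. -/
noncomputable abbrev SingReal (X : Type) [TopologicalSpace X] : Type :=
  SSet.toTop.obj (TopCat.toSSet.obj (TopCat.of X))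

section
open Simplicial
variable {X Y Z : Type} [TopologicalSpace X] [TopologicalSpace Y] [TopologicalSpace Z]

/-- The point of `|X|` with coordinates `w` in the closed cell of a singular simplex of `X`. -/
noncomputable def scell {n : ℕ} (s : C(stdSimplex ℝ (Fin (n + 1)), X))
    (w : stdSimplex ℝ (Fin (n + 1))) : SingReal X :=
  cell _ ((TopCat.toSSetObjEquiv (TopCat.of X) (op ⦋n⦌)).symm s) w

/-- The map `|X| → |Y|` induced by a continuous map. -/
noncomputable def realMap (f : C(X, Y)) : C(SingReal X, SingReal Y) :=
  (SSet.toTop.map (TopCat.toSSet.map (TopCat.ofHom f))).hom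

theorem continuous_scell {n : ℕ} (s : C(stdSimplex ℝ (Fin (n + 1)), X)) : Continuous (scell s) :=
  continuous_cell _ _

/-- The affine map of simplices induced by a monotone map of vertices. -/
noncomputable def affineMap {m n : ℕ} (f : Fin (m + 1) →o Fin (n + 1)) :
    C(stdSimplex ℝ (Fin (m + 1)), stdSimplex ℝ (Fin (n + 1))) :=
  ⟨stdSimplex.map f, stdSimplex.continuous_map f⟩

theorem scell_affineMap {m n : ℕ} (s : C(stdSimplex ℝ (Fin (n + 1)), X))
    (f : Fin (m + 1) →o Fin (n + 1)) (w : stdSimplex ℝ (Fin (m + 1))) :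
    scell (s.comp (affineMap f)) w = scell s (stdSimplex.map f w) :=
  cell_map _ ((TopCat.toSSetObjEquiv (TopCat.of X) (op ⦋n⦌)).symm s)
    (SimplexCategory.Hom.mk f) w

theorem realMap_scell (f : C(X, Y)) {n : ℕ} (s : C(stdSimplex ℝ (Fin (n + 1)), X))
    (w : stdSimplex ℝ (Fin (n + 1))) : realMap f (scell s w) = scell (f.comp s) w :=
  map_cell _ _ _

theorem realMap_id (x : SingReal X) : realMap (ContinuousMap.id X) x = x := by
  have : TopCat.ofHom (ContinuousMap.id X) = 𝟙 (TopCat.of X) := rfl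
  simp [realMap, this]

theorem realMap_comp (g : C(Y, Z)) (f : C(X, Y)) (x : SingReal X) :
    realMap (g.comp f) x = realMap g (realMap f x) := by
  have : TopCat.ofHom (g.comp f) = TopCat.ofHom f ≫ TopCat.ofHom g := rfl
  simp [realMap, this]

theorem exists_scell (x : SingReal X) :
    ∃ (n : ℕ) (s : C(stdSimplex ℝ (Fin (n + 1)), X)) (w : _), scell s w = x := by
  obtain ⟨n, s, w, h⟩ := exists_cell x
  exact ⟨n, TopCat.toSSetObjEquiv (TopCat.of X) (op ⦋n⦌) s, w, by simpa [scell] using h⟩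

theorem exists_sdesc
    (φ : ∀ n : ℕ, C(stdSimplex ℝ (Fin (n + 1)), X) → C(stdSimplex ℝ (Fin (n + 1)), Z))
    (hφ : ∀ (m n : ℕ) (f : Fin (m + 1) →o Fin (n + 1)) s w,
      φ m (s.comp (affineMap f)) w = φ n s (stdSimplex.map f w)) :
    ∃ F : C(SingReal X, Z), ∀ (n : ℕ) s w, F (scell s w) = φ n s w := by
  obtain ⟨F, hF⟩ := exists_desc (TopCat.toSSet.obj (TopCat.of X)) (W := Z)
    (fun n s => φ n (TopCat.toSSetObjEquiv (TopCat.of X) (op ⦋n⦌) s))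
    (fun m n f s w => hφ m n f.toOrderHom (TopCat.toSSetObjEquiv (TopCat.of X) (op ⦋n⦌) s) w)
  exact ⟨F, fun n s w => by simp [scell, hF]⟩

/-- `|X × Y| → |X| × |Y|`. -/
noncomputable def realProj (z : SingReal (X × Y)) : SingReal X × SingReal Y :=
  (realMap ContinuousMap.fst z, realMap ContinuousMap.snd z)

theorem scell_eq_of_simplexMap_eq {m n p q : ℕ} (s : C(stdSimplex ℝ (Fin (m + 1)), X))
    (t : C(stdSimplex ℝ (Fin (n + 1)), Y)) (f : Fin (p + 1) →o Fin (m + 1))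
    (g : Fin (p + 1) →o Fin (n + 1)) (f' : Fin (q + 1) →o Fin (m + 1))
    (g' : Fin (q + 1) →o Fin (n + 1)) (z : stdSimplex ℝ (Fin (p + 1)))
    (z' : stdSimplex ℝ (Fin (q + 1))) (hf : stdSimplex.map f z = stdSimplex.map f' z')
    (hg : stdSimplex.map g z = stdSimplex.map g' z') :
    scell ((s.comp (affineMap f)).prodMk (t.comp (affineMap g))) z =
      scell ((s.comp (affineMap f')).prodMk (t.comp (affineMap g'))) z' := by
  obtain ⟨r, -, y, a, b, hy, rfl, rfl⟩ := exists_common_subdivision z z'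
  rw [stdSimplex.map_comp_apply, stdSimplex.map_comp_apply] at hf hg
  have h1 : f.comp a = f'.comp b := eq_of_simplexMap_eq hy hf
  have h2 : g.comp a = g'.comp b := eq_of_simplexMap_eq hy hg
  rw [← scell_affineMap, ← scell_affineMap]
  have e : ∀ {k l : ℕ} (c : Fin (r + 1) →o Fin (k + 1)) (f : Fin (k + 1) →o Fin (l + 1)),
      (affineMap f).comp (affineMap c) = affineMap (f.comp c) := by
    intro k l c f
    ext w : 1
    exact stdSimplex.map_comp_apply _ _ _
  congr 1
  ext w
  · change s ((affineMap f).comp (affineMap a) w) = s ((affineMap f').comp (affineMap b) w)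
    rw [e, e, h1]
  · change t ((affineMap g).comp (affineMap a) w) = t ((affineMap g').comp (affineMap b) w)
    rw [e, e, h2]

theorem exists_lift_of_surjective {P Q W : Type} [TopologicalSpace P] [CompactSpace P]
    [TopologicalSpace Q] [T2Space Q] [TopologicalSpace W] {π : P → Q} (hπ : Continuous π)
    (hs : Function.Surjective π) {Φ : P → W} (hΦ : Continuous Φ)
    (h : ∀ x y, π x = π y → Φ x = Φ y) : ∃ L : C(Q, W), ∀ x, L (π x) = Φ x := by
  have hq : IsQuotientMap π := hπ.isClosedMap.isQuotientMap hπ hs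
  have e : ∀ x, Φ (Function.surjInv hs (π x)) = Φ x := fun x =>
    h _ _ (Function.surjInv_eq hs (π x))
  refine ⟨⟨fun v => Φ (Function.surjInv hs v), ?_⟩, e⟩
  rw [hq.continuous_iff]
  exact hΦ.congr fun x => (e x).symm

instance (a b : ℕ) : Finite (Fin a →o Fin b) :=
  Finite.of_injective (fun f : Fin a →o Fin b => (f : Fin a → Fin b)) DFunLike.coe_injective

theorem exists_prodCell {m n : ℕ} (s : C(stdSimplex ℝ (Fin (m + 1)), X))
    (t : C(stdSimplex ℝ (Fin (n + 1)), Y)) :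
    ∃ F : C(stdSimplex ℝ (Fin (m + 1)) × stdSimplex ℝ (Fin (n + 1)), SingReal (X × Y)),
      ∀ (q : ℕ) (f : Fin (q + 1) →o Fin (m + 1)) (g : Fin (q + 1) →o Fin (n + 1)) z,
        F (stdSimplex.map f z, stdSimplex.map g z) =
          scell ((s.comp (affineMap f)).prodMk (t.comp (affineMap g))) z := by
  obtain ⟨L, hL⟩ := exists_lift_of_surjective
    (P := (j : (q : Fin (m + n + 2)) × (Fin (q + 1) →o Fin (m + 1)) × (Fin (q + 1) →o Fin (n + 1)))
      × stdSimplex ℝ (Fin (j.1 + 1)))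
    (π := fun x => (affineMap x.1.2.1 x.2, affineMap x.1.2.2 x.2))
    (Φ := fun x => scell ((s.comp (affineMap x.1.2.1)).prodMk (t.comp (affineMap x.1.2.2))) x.2)
    (by
      rw [continuous_sigma_iff]
      rintro ⟨k, f, g⟩
      exact (affineMap f).continuous.prodMk (affineMap g).continuous)
    (by
      rintro ⟨u, v⟩
      obtain ⟨q, hq, z, f, g, -, hf, hg⟩ := exists_common_subdivision u v
      exact ⟨⟨⟨⟨q, hq⟩, f, g⟩, z⟩, Prod.ext hf hg⟩)
    (by
      rw [continuous_sigma_iff]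
      rintro ⟨k, f, g⟩
      exact continuous_scell ((s.comp (affineMap f)).prodMk (t.comp (affineMap g))))
    (by
      rintro ⟨⟨k, f, g⟩, x⟩ ⟨⟨k', f', g'⟩, y⟩ h
      exact scell_eq_of_simplexMap_eq s t f g f' g' x y (congrArg Prod.fst h)
        (congrArg Prod.snd h))
  refine ⟨L, fun q f g z => ?_⟩
  obtain ⟨r, hr, y, a, b, -, ha, hb⟩ :=
    exists_common_subdivision (stdSimplex.map f z) (stdSimplex.map g z)
  rw [← ha, ← hb]
  refine (hL ⟨⟨⟨r, hr⟩, a, b⟩, y⟩).trans ?_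
  exact scell_eq_of_simplexMap_eq s t a b f g y z ha hb

/-- The product map on realizations; it is continuous for the compactly generated topology. -/
theorem exists_realPair : ∃ μ : C(SingReal X, C(SingReal Y, SingReal (X × Y))),
    (∀ z : SingReal (X × Y), μ (realProj z).1 (realProj z).2 = z) ∧
    (∀ x y, realProj (μ x y) = (x, y)) := by
  choose F hF using @exists_prodCell X Y _ _
  have hnat : ∀ {m n m' n' : ℕ} (s : C(stdSimplex ℝ (Fin (m + 1)), X))
      (t : C(stdSimplex ℝ (Fin (n + 1)), Y)) (a : Fin (m' + 1) →o Fin (m + 1))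
      (b : Fin (n' + 1) →o Fin (n + 1)) u v,
      F (s.comp (affineMap a)) (t.comp (affineMap b)) (u, v) =
        F s t (stdSimplex.map a u, stdSimplex.map b v) := by
    intro m n m' n' s t a b u v
    obtain ⟨q, -, z, f, g, -, rfl, rfl⟩ := exists_common_subdivision u v
    rw [hF, stdSimplex.map_comp_apply, stdSimplex.map_comp_apply]
    have := hF s t q (a.comp f) (b.comp g) z
    refine Eq.trans ?_ this.symm
    congr 1
    ext w
    · exact congrArg s (stdSimplex.map_comp_apply _ _ _)
    · exact congrArg t (stdSimplex.map_comp_apply _ _ _)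
  have e0 : ∀ k, affineMap (OrderHom.id : Fin (k + 1) →o Fin (k + 1)) = ContinuousMap.id _ := by
    intro k
    ext w : 1
    exact stdSimplex.map_id_apply w
  have hnat1 : ∀ {m n m' : ℕ} (s : C(stdSimplex ℝ (Fin (m + 1)), X))
      (t : C(stdSimplex ℝ (Fin (n + 1)), Y)) (a : Fin (m' + 1) →o Fin (m + 1)) u v,
      F (s.comp (affineMap a)) t (u, v) = F s t (stdSimplex.map a u, v) := by
    intro m n m' s t a u v
    have := hnat s t a OrderHom.id u v
    rw [e0, ContinuousMap.comp_id] at this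
    rw [this]
    simp
  have hnat2 : ∀ {m n n' : ℕ} (s : C(stdSimplex ℝ (Fin (m + 1)), X))
      (t : C(stdSimplex ℝ (Fin (n + 1)), Y)) (b : Fin (n' + 1) →o Fin (n + 1)) u v,
      F s (t.comp (affineMap b)) (u, v) = F s t (u, stdSimplex.map b v) := by
    intro m n n' s t b u v
    have := hnat s t OrderHom.id b u v
    rw [e0, ContinuousMap.comp_id] at this
    rw [this]
    simp
  have hG : ∀ {m : ℕ} (s : C(stdSimplex ℝ (Fin (m + 1)), X)),
      ∃ G : C(SingReal Y, C(stdSimplex ℝ (Fin (m + 1)), SingReal (X × Y))),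
        ∀ (n : ℕ) (t : C(stdSimplex ℝ (Fin (n + 1)), Y)) v u, G (scell t v) u = F s t (u, v) := by
    intro m s
    obtain ⟨G, hG⟩ := exists_sdesc (X := Y)
      (fun n t => ((F s t).comp ContinuousMap.prodSwap).curry)
      (fun n n' b t v => by
        ext u
        exact hnat2 s t b u v)
    exact ⟨G, fun n t v u => by rw [hG]; rfl⟩
  choose G hG using @hG
  obtain ⟨μ, hμ⟩ := exists_sdesc (X := X) (Z := C(SingReal Y, SingReal (X × Y)))
    (fun m s => ((G s).uncurry.comp ContinuousMap.prodSwap).curry)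
    (fun m n a s u => by
      ext y
      obtain ⟨k, t, v, rfl⟩ := exists_scell y
      change G (s.comp (affineMap a)) (scell t v) u = G s (scell t v) (stdSimplex.map a u)
      rw [hG, hG, hnat1])
  have hμF : ∀ {m n : ℕ} (s : C(stdSimplex ℝ (Fin (m + 1)), X))
      (t : C(stdSimplex ℝ (Fin (n + 1)), Y)) u v, μ (scell s u) (scell t v) = F s t (u, v) := by
    intro m n s t u v
    rw [hμ]
    exact hG _ _ _ _ _
  refine ⟨μ, fun z => ?_, fun x y => ?_⟩
  · obtain ⟨k, t, v, rfl⟩ := exists_scell z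
    simp only [realProj, realMap_scell]
    rw [hμF]
    have := hF (ContinuousMap.fst.comp t) (ContinuousMap.snd.comp t) k OrderHom.id OrderHom.id v
    have hid : stdSimplex.map (S := ℝ) (OrderHom.id : Fin (k + 1) →o Fin (k + 1)) v = v :=
      stdSimplex.map_id_apply v
    simp only [e0, ContinuousMap.comp_id, hid] at this
    rw [this]
    congr 1
  · obtain ⟨m, s, u, rfl⟩ := exists_scell x
    obtain ⟨n, t, v, rfl⟩ := exists_scell y
    rw [hμF]
    obtain ⟨q, -, z, f, g, -, rfl, rfl⟩ := exists_common_subdivision u v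
    rw [hF]
    simp only [realProj, realMap_scell]
    exact Prod.ext (scell_affineMap s f z) (scell_affineMap t g z)

/-- The canonical identification `|X| × |Y| = |X × Y|`. -/
noncomputable def realPair : C(SingReal X, C(SingReal Y, SingReal (X × Y))) := exists_realPair.choose

theorem realPair_realProj (z : SingReal (X × Y)) :
    realPair (realMap ContinuousMap.fst z) (realMap ContinuousMap.snd z) = z :=
  exists_realPair.choose_spec.1 z

theorem realMap_fst_realPair (x : SingReal X) (y : SingReal Y) :
    realMap ContinuousMap.fst (realPair x y) = x :=
  congrArg Prod.fst (exists_realPair.choose_spec.2 x y)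

theorem realMap_snd_realPair (x : SingReal X) (y : SingReal Y) :
    realMap ContinuousMap.snd (realPair x y) = y :=
  congrArg Prod.snd (exists_realPair.choose_spec.2 x y)

end
end RefinedTransfer
/-! ### Pointed spaces and smash products -/
namespace RefinedTransfer
open scoped unitInterval

/-- A pointed compactly generated space. -/
structure PtSpace where
  carrier : Type
  [top : TopologicalSpace carrier]
  [cg : CompactlyGeneratedSpace carrier]
  pt : carrier

namespace PtSpace
instance : CoeSort PtSpace Type := ⟨PtSpace.carrier⟩
instance (X : PtSpace) : TopologicalSpace X := X.top
instance (X : PtSpace) : CompactlyGeneratedSpace X := X.cg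

/-- Base point preserving continuous maps. -/
@[ext]
structure Hom (X Y : PtSpace) where
  toFun : C(X, Y)
  map_pt : toFun X.pt = Y.pt

instance : Category PtSpace where
  Hom := Hom
  id X := ⟨ContinuousMap.id X, rfl⟩
  comp f g := ⟨g.toFun.comp f.toFun, by simp [f.map_pt, g.map_pt]⟩

instance {X Y : PtSpace} : FunLike (X ⟶ Y) X Y where
  coe f := f.toFun
  coe_injective _ _ h := Hom.ext (DFunLike.coe_injective h)

theorem hom_ext {X Y : PtSpace} {f g : X ⟶ Y} (h : ∀ x, f x = g x) : f = g := DFunLike.ext _ _ h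
theorem continuous {X Y : PtSpace} (f : X ⟶ Y) : Continuous f := f.toFun.continuous
@[simp] theorem apply_pt {X Y : PtSpace} (f : X ⟶ Y) : f X.pt = Y.pt := f.map_pt
@[simp] theorem id_apply {X : PtSpace} (x : X) : (𝟙 X : X ⟶ X) x = x := rfl
@[simp] theorem comp_apply {X Y Z : PtSpace} (f : X ⟶ Y) (g : Y ⟶ Z) (x : X) :
    (f ≫ g) x = g (f x) := rfl
end PtSpace

/-- The equivalence relation which collapses a subset to a point. -/
def collapse {W : Type} (Z : Set W) : Setoid W where
  r a b := a = b ∨ (a ∈ Z ∧ b ∈ Z)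
  iseqv :=
    { refl := fun _ => Or.inl rfl
      symm := by rintro a b (rfl | ⟨h, h'⟩) <;> tauto
      trans := by rintro a b c (rfl | ⟨h, h'⟩) (rfl | ⟨k, k'⟩) <;> tauto }

/-- The underlying set of the smash product `X ∧ Y`. -/
def SmashCarrier (X Y : PtSpace) : Type :=
  Quotient (collapse {q : X × Y | q.1 = X.pt ∨ q.2 = Y.pt})

/-- The point `x ∧ y` of the smash product. -/
def smk {X Y : PtSpace} (x : X) (y : Y) : SmashCarrier X Y := Quotient.mk _ (x, y)

/-- The smash product carries the quotient topology of the compactly generated topology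
on the product. -/
instance (X Y : PtSpace) : TopologicalSpace (SmashCarrier X Y) :=
  TopologicalSpace.coinduced (fun q : X × Y => smk q.1 q.2)
    (TopologicalSpace.compactlyGenerated.{0} (X × Y))

theorem continuous_smk {X Y : PtSpace} {K : Type} [TopologicalSpace K] [CompactSpace K] [T2Space K]
    {a : K → X} {b : K → Y} (ha : Continuous a) (hb : Continuous b) :
    Continuous fun k => smk (a k) (b k) := by
  have h1 : Continuous[_, TopologicalSpace.compactlyGenerated.{0} (X × Y)]
      (fun k => (a k, b k)) := by
    let f : (Σ (i : (S : CompHaus.{0}) × C(S, X × Y)), i.fst) → X × Y := fun ⟨⟨_, i⟩, s⟩ => i s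
    have hf : @Continuous _ _ _ (TopologicalSpace.compactlyGenerated.{0} (X × Y)) f :=
      continuous_coinduced_rng
    have hk : Continuous (fun k : K =>
        (⟨⟨CompHaus.of K, ⟨fun k => (a k, b k), ha.prodMk hb⟩⟩, k⟩ :
          Σ (i : (S : CompHaus.{0}) × C(S, X × Y)), i.fst)) :=
      @continuous_sigmaMk ((S : CompHaus.{0}) × C(S, X × Y)) (fun i => i.fst) _
        ⟨CompHaus.of K, ⟨fun k => (a k, b k), ha.prodMk hb⟩⟩
    exact @Continuous.comp _ _ _ _ _ (TopologicalSpace.compactlyGenerated.{0} (X × Y)) _ _ hf hk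
  exact @Continuous.comp _ _ _ _ (TopologicalSpace.compactlyGenerated.{0} (X × Y)) _ _ _
    continuous_coinduced_rng h1

theorem continuous_smash_iff {X Y : PtSpace} {Z : Type} [TopologicalSpace Z]
    (f : SmashCarrier X Y → Z)
    (h : ∀ (K : Type) [TopologicalSpace K] [CompactSpace K] [T2Space K] (a : K → X) (b : K → Y),
      Continuous a → Continuous b → Continuous fun k => f (smk (a k) (b k))) :
    Continuous f := by
  rw [continuous_coinduced_dom]
  apply continuous_from_compactlyGenerated
  intro S g
  exact h S _ _ (continuous_fst.comp g.continuous) (continuous_snd.comp g.continuous)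

instance (X Y : PtSpace) : CompactlyGeneratedSpace (SmashCarrier X Y) := by
  apply compactlyGeneratedSpace_of_continuous_maps
  intro Z _ f h
  exact continuous_smash_iff f fun K _ _ _ a b ha hb => h K _ (continuous_smk ha hb)

/-- The smash product `X ∧ Y`. -/
def smash (X Y : PtSpace) : PtSpace := ⟨SmashCarrier X Y, smk X.pt Y.pt⟩

/-- The point `x ∧ y` of the smash product. -/
def tmul {X Y : PtSpace} (x : X) (y : Y) : smash X Y := smk x y

theorem tmul_eq_pt {X Y : PtSpace} (x : X) (y : Y) (h : x = X.pt ∨ y = Y.pt) :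
    tmul x y = (smash X Y).pt :=
  Quotient.sound (Or.inr ⟨h, Or.inl rfl⟩)

theorem exists_tmul {X Y : PtSpace} (z : smash X Y) : ∃ x y, tmul x y = z := by
  induction z using Quotient.inductionOn with
  | _ q => exact ⟨q.1, q.2, rfl⟩

/-- A map out of a smash product, from a map of two variables which is continuous for the
compactly generated topology on the product. -/
def smashLift {X Y Z : PtSpace} (f : X → Y → Z) (hl : ∀ y, f X.pt y = Z.pt)
    (hr : ∀ x, f x Y.pt = Z.pt)
    (hc : ∀ (K : Type) [TopologicalSpace K] [CompactSpace K] [T2Space K] (a : K → X) (b : K → Y),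
      Continuous a → Continuous b → Continuous fun k => f (a k) (b k)) : smash X Y ⟶ Z where
  toFun :=
    { toFun := Quotient.lift (fun q : X × Y => f q.1 q.2) (by
        rintro ⟨a, b⟩ ⟨c, d⟩ (h | ⟨h | h, h' | h'⟩)
        · rw [h]
        all_goals simp only at h h'; subst h h'; simp [hl, hr])
      continuous_toFun := continuous_smash_iff _ hc }
  map_pt := hl Y.pt

@[simp] theorem smashLift_tmul {X Y Z : PtSpace} (f : X → Y → Z) (hl hr hc) (x : X) (y : Y) :
    smashLift (Z := Z) f hl hr hc (tmul x y) = f x y := rfl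

/-- The smash product of two maps. -/
def smashMap {X X' Y Y' : PtSpace} (f : X ⟶ X') (g : Y ⟶ Y') : smash X Y ⟶ smash X' Y' :=
  smashLift (fun x y => tmul (f x) (g y)) (fun _ => tmul_eq_pt _ _ (Or.inl (by simp)))
    (fun _ => tmul_eq_pt _ _ (Or.inr (by simp)))
    (fun _ _ _ _ _ _ ha hb => continuous_smk ((PtSpace.continuous f).comp ha)
      ((PtSpace.continuous g).comp hb))

@[simp] theorem smashMap_tmul {X X' Y Y' : PtSpace} (f : X ⟶ X') (g : Y ⟶ Y') (x : X) (y : Y) :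
    smashMap f g (tmul x y) = tmul (f x) (g y) := rfl

/-- `K⁺`: a compact Hausdorff space with a disjoint base point. -/
def plus (K : Type) [TopologicalSpace K] [CompactSpace K] [T2Space K] : PtSpace :=
  ⟨K ⊕ Unit, Sum.inr ()⟩

/-- The point of `K⁺` given by a point of `K`. -/
def toPlus {K : Type} [TopologicalSpace K] [CompactSpace K] [T2Space K] (k : K) : plus K :=
  Sum.inl k

/-- The map `K⁺ → K'⁺` induced by a continuous map. -/
def plusMap {K K' : Type} [TopologicalSpace K] [CompactSpace K] [T2Space K] [TopologicalSpace K']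
    [CompactSpace K'] [T2Space K'] (f : C(K, K')) : plus K ⟶ plus K' where
  toFun := ⟨Sum.map f id, f.continuous.sumMap continuous_id⟩
  map_pt := rfl

/-- A map on the product of a compactly generated space with a compact Hausdorff space is
continuous as soon as it is continuous on compact Hausdorff spaces. -/
theorem continuous_prod_of_compact {X K Z : Type} [TopologicalSpace X] [CompactlyGeneratedSpace X]
    [TopologicalSpace K] [CompactSpace K] [T2Space K] [TopologicalSpace Z] (f : X → K → Z)
    (h : ∀ (S : Type) [TopologicalSpace S] [CompactSpace S] [T2Space S] (a : S → X) (b : S → K),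
      Continuous a → Continuous b → Continuous fun s => f (a s) (b s)) :
    Continuous fun q : X × K => f q.1 q.2 := by
  have h1 : ∀ x, Continuous (f x) := fun x => h K (fun _ => x) id continuous_const continuous_id
  have h2 : Continuous fun x => (⟨f x, h1 x⟩ : C(K, Z)) := by
    apply continuous_from_compactlyGeneratedSpace
    intro S _ _ _ g hg
    apply ContinuousMap.continuous_of_continuous_uncurry
    exact h (S × K) (fun q => g q.1) (fun q => q.2) (hg.comp continuous_fst) continuous_snd
  exact ContinuousMap.continuous_uncurry_of_continuous ⟨_, h2⟩

theorem continuous_tmul_plus (X : PtSpace) (K : Type) [TopologicalSpace K] [CompactSpace K]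
    [T2Space K] : Continuous fun q : X × K => (tmul q.1 (toPlus q.2) : smash X (plus K)) := by
  apply continuous_prod_of_compact (fun (x : X) (k : K) => (tmul x (toPlus k) : smash X (plus K)))
  intro S _ _ _ a b ha hb
  exact continuous_smk (Y := plus K) ha (continuous_inl.comp hb)

/-! ### Path classes -/

/-- A path from `f` to `g` in the space of pointed maps from `X` to `Y`, that is, a base point
preserving homotopy. -/
abbrev MapPath {X Y : PtSpace} (f g : X ⟶ Y) : Type :=
  ContinuousMap.HomotopyRel f.toFun g.toFun {X.pt}

namespace MapPath
variable {X Y Z : PtSpace}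

/-- Two paths in the space of pointed maps are in the same path class if they are homotopic through
base point preserving homotopies, relative to their end points. -/
def SameClass {f g : X ⟶ Y} (p q : MapPath f g) : Prop :=
  p.toContinuousMap.HomotopicRel q.toContinuousMap
    {z : I × X | z.1 = 0 ∨ z.1 = 1 ∨ z.2 = X.pt}

/-- The path given by a map `X ∧ I⁺ → Y`. -/
def ofSmash (K : smash X (plus I) ⟶ Y) (f g : X ⟶ Y) (hf : ∀ x, K (tmul x (toPlus 0)) = f x)
    (hg : ∀ x, K (tmul x (toPlus 1)) = g x) : MapPath f g where
  toFun z := K (tmul z.2 (toPlus z.1))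
  continuous_toFun := (PtSpace.continuous K).comp
    ((continuous_tmul_plus X I).comp continuous_swap)
  map_zero_left := hf
  map_one_left := hg
  prop' t x hx := by
    rw [Set.mem_singleton_iff.1 hx]
    change K (tmul X.pt (toPlus t)) = f X.pt
    rw [tmul_eq_pt _ _ (Or.inl rfl)]
    simp

/-- Composition of a path of maps with a map of the target. -/
def postcomp {f g : X ⟶ Y} (p : MapPath f g) (k : Y ⟶ Z) : MapPath (f ≫ k) (g ≫ k) where
  toFun z := k (p z)
  continuous_toFun := (PtSpace.continuous k).comp p.continuous
  map_zero_left x := congrArg k (p.apply_zero x)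
  map_one_left x := congrArg k (p.apply_one x)
  prop' t x hx := congrArg k (p.prop t x hx)

/-- Composition of a path of maps with a map of the source. -/
def precomp (k : X ⟶ Y) {f g : Y ⟶ Z} (p : MapPath f g) : MapPath (k ≫ f) (k ≫ g) where
  toFun z := p (z.1, k z.2)
  continuous_toFun := p.continuous.comp (by
    have := PtSpace.continuous k
    fun_prop)
  map_zero_left x := p.apply_zero _
  map_one_left x := p.apply_one _
  prop' t x hx := by
    apply p.prop t
    rw [Set.mem_singleton_iff.1 hx]
    simp
end MapPath

end RefinedTransfer
/-! ### Pairs of compact spaces and multiplicative functors -/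
namespace RefinedTransfer
open scoped unitInterval

/-- A pair `(X, A)` of compact Hausdorff spaces. -/
structure CPair where
  carrier : Type
  [top : TopologicalSpace carrier]
  [compact : CompactSpace carrier]
  [t2 : T2Space carrier]
  sub : Set carrier
  closed : IsClosed sub

namespace CPair
instance : CoeSort CPair Type := ⟨CPair.carrier⟩
instance (P : CPair) : TopologicalSpace P := P.top
instance (P : CPair) : CompactSpace P := P.compact
instance (P : CPair) : T2Space P := P.t2

/-- Maps of pairs. -/
@[ext]
structure Hom (P Q : CPair) where
  toFun : C(P, Q)
  mapsTo : MapsTo toFun P.sub Q.sub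

instance : Category CPair where
  Hom := Hom
  id P := ⟨ContinuousMap.id P, fun _ h => h⟩
  comp f g := ⟨g.toFun.comp f.toFun, fun _ h => g.mapsTo (f.mapsTo h)⟩

theorem hom_ext {P Q : CPair} {f g : P ⟶ Q} (h : ∀ x, f.toFun x = g.toFun x) : f = g :=
  Hom.ext (DFunLike.ext _ _ h)

/-- `(X, A) × (Y, B) = (X × Y, A × Y ∪ X × B)`. -/
def prod (P Q : CPair) : CPair where
  carrier := P × Q
  sub := {z | z.1 ∈ P.sub ∨ z.2 ∈ Q.sub}
  closed := (P.closed.preimage continuous_fst).union (Q.closed.preimage continuous_snd)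

/-- The product of two maps of pairs. -/
def prodMap {P P' Q Q' : CPair} (f : P ⟶ P') (g : Q ⟶ Q') : P.prod Q ⟶ P'.prod Q' where
  toFun := f.toFun.prodMap g.toFun
  mapsTo _ h := h.imp (fun h => f.mapsTo h) (fun h => g.mapsTo h)

/-- The pair `(X, ∅)`. -/
def abs (X : Type) [TopologicalSpace X] [CompactSpace X] [T2Space X] : CPair := ⟨X, ∅, isClosed_empty⟩

/-- The one point space. -/
def point : CPair := abs Unit

/-- The projection `(X, A) × * → (X, A)`. -/
def fst (P : CPair) : P.prod point ⟶ P where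
  toFun := ContinuousMap.fst
  mapsTo _ h := h.elim id (fun h => h.elim)

/-- The associativity of the product of pairs. -/
def assoc (P Q R : CPair) : (P.prod Q).prod R ⟶ P.prod (Q.prod R) where
  toFun := ⟨fun z => (z.1.1, (z.1.2, z.2)), by fun_prop⟩
  mapsTo _ h := or_assoc.1 h

/-- The inclusion `(X, A) → (X, A) × I` at the parameter `t`. -/
def incl (P : CPair) (t : I) : P ⟶ P.prod (abs I) where
  toFun := ⟨fun x => (x, t), by fun_prop⟩
  mapsTo _ h := Or.inl h
end CPair

/-- The part of `|X|` with added base point which is collapsed in `|X| / |A|`. -/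
def LSub (P : CPair) : Set (SingReal P ⊕ Unit) :=
  Sum.inl '' range (realMap (⟨Subtype.val, continuous_subtype_val⟩ : C(P.sub, P))) ∪ {Sum.inr ()}

/-- The pointed space `L(X, A) = |X| / |A|` (so that `L(X, ∅)` is `|X|` with a disjoint base
point). -/
noncomputable def LObj (P : CPair) : PtSpace :=
  ⟨Quotient (collapse (LSub P)), Quotient.mk _ (Sum.inr ())⟩

/-- The image in `|X| / |A|` of a point of `|X|`. -/
noncomputable def lmk {P : CPair} (x : SingReal P) : LObj P := Quotient.mk _ (Sum.inl x)

theorem continuous_lmk {P : CPair} : Continuous (lmk : SingReal P → LObj P) :=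
  continuous_quotient_mk'.comp continuous_inl

theorem lmk_eq_pt {P : CPair} (x : SingReal P.sub) :
    lmk (realMap (⟨Subtype.val, continuous_subtype_val⟩ : C(P.sub, P)) x) = (LObj P).pt :=
  Quotient.sound (Or.inr ⟨Or.inl ⟨_, ⟨_, rfl⟩, rfl⟩, Or.inr rfl⟩)

theorem lobj_cases {P : CPair} (x : LObj P) : (∃ y, lmk y = x) ∨ x = (LObj P).pt := by
  induction x using Quotient.inductionOn with
  | _ q =>
    rcases q with y | ⟨⟩
    · exact Or.inl ⟨y, rfl⟩
    · exact Or.inr rfl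

theorem lmk_eq_pt_of_mapsTo {Z : Type} [TopologicalSpace Z] {P : CPair} (f : C(Z, P))
    (h : ∀ z, f z ∈ P.sub) (x : SingReal Z) : lmk (realMap f x) = (LObj P).pt := by
  have : f = (⟨Subtype.val, continuous_subtype_val⟩ : C(P.sub, P)).comp
    ⟨fun z => ⟨f z, h z⟩, by fun_prop⟩ := rfl
  rw [this, realMap_comp]
  exact lmk_eq_pt _

/-- The map `|X| / |A| → |Y| / |B|` induced by a map of pairs. -/
noncomputable def LMap {P Q : CPair} (f : P ⟶ Q) : LObj P ⟶ LObj Q where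
  toFun :=
    { toFun := Quotient.lift (Sum.elim (fun x => lmk (realMap f.toFun x)) (fun _ => (LObj Q).pt)) (by
        have key : ∀ a ∈ LSub P, Sum.elim (fun x => (lmk (realMap f.toFun x) : LObj Q))
            (fun _ => (LObj Q).pt) a = (LObj Q).pt := by
          rintro a (⟨_, ⟨x, rfl⟩, rfl⟩ | rfl)
          · simp only [Sum.elim_inl]
            rw [← realMap_comp]
            exact lmk_eq_pt_of_mapsTo _ (fun z : P.sub => f.mapsTo z.2) x
          · rfl
        rintro a b (rfl | ⟨ha, hb⟩)
        · rfl
        · rw [key a ha, key b hb])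
      continuous_toFun := by
        apply Continuous.quotient_lift
        exact (continuous_lmk.comp (realMap f.toFun).continuous).sumElim continuous_const }
  map_pt := rfl

theorem LMap_lmk {P Q : CPair} (f : P ⟶ Q) (x : SingReal P) :
    LMap f (lmk x) = lmk (realMap f.toFun x) := rfl

/-- The functor `L` from pairs of compact spaces to pointed spaces. -/
noncomputable def LFun : CPair ⥤ PtSpace where
  obj := LObj
  map := LMap
  map_id P := by
    apply PtSpace.hom_ext
    intro x
    rcases lobj_cases x with ⟨y, rfl⟩ | rfl
    · rw [LMap_lmk]
      exact congrArg lmk (realMap_id y)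
    · simp
  map_comp f g := by
    apply PtSpace.hom_ext
    intro x
    rcases lobj_cases x with ⟨y, rfl⟩ | rfl
    · rw [LMap_lmk, PtSpace.comp_apply, LMap_lmk, LMap_lmk]
      exact congrArg lmk (realMap_comp _ _ y)
    · simp

section pairing
variable {X X' Y Y' Z Z' : Type} [TopologicalSpace X] [TopologicalSpace X'] [TopologicalSpace Y]
  [TopologicalSpace Y'] [TopologicalSpace Z] [TopologicalSpace Z']

theorem realProj_injective {a b : SingReal (X × Y)}
    (h1 : realMap ContinuousMap.fst a = realMap ContinuousMap.fst b)
    (h2 : realMap ContinuousMap.snd a = realMap ContinuousMap.snd b) : a = b := by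
  rw [← realPair_realProj a, ← realPair_realProj b, h1, h2]

theorem realMap_realPair (f : C(X, X')) (g : C(Y, Y')) (x : SingReal X) (y : SingReal Y) :
    realMap (f.prodMap g) (realPair x y) = realPair (realMap f x) (realMap g y) := by
  apply realProj_injective
  · rw [← realMap_comp, realMap_fst_realPair]
    have : ContinuousMap.fst.comp (f.prodMap g) = f.comp ContinuousMap.fst := rfl
    rw [this, realMap_comp, realMap_fst_realPair]
  · rw [← realMap_comp, realMap_snd_realPair]
    have : ContinuousMap.snd.comp (f.prodMap g) = g.comp ContinuousMap.snd := rfl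
    rw [this, realMap_comp, realMap_snd_realPair]

theorem continuous_realPair {K : Type} [TopologicalSpace K] [CompactSpace K] [T2Space K]
    {a : K → SingReal X} {b : K → SingReal Y} (ha : Continuous a) (hb : Continuous b) :
    Continuous fun k => realPair (a k) (b k) := by
  have h1 : Continuous fun k => (realPair (a k)).comp ⟨b, hb⟩ :=
    (ContinuousMap.continuous_precomp _).comp (realPair.continuous.comp ha)
  exact (ContinuousMap.continuous_uncurry_of_continuous ⟨_, h1⟩).comp
    (continuous_id.prodMk continuous_id)

/-- Continuity on compact spaces of a function of two variables descends along quotient maps. -/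
theorem continuous_of_quotients {A A' B B' W : Type} [TopologicalSpace A] [TopologicalSpace A']
    [TopologicalSpace B] [TopologicalSpace B'] [TopologicalSpace W] [CompactlyGeneratedSpace A]
    [CompactlyGeneratedSpace B] {q : A → A'} {r : B → B'} (hq : IsQuotientMap q)
    (hr : IsQuotientMap r) (f : A' → B' → W)
    (h : ∀ (K : Type) [TopologicalSpace K] [CompactSpace K] [T2Space K] (a : K → A) (b : K → B),
      Continuous a → Continuous b → Continuous fun k => f (q (a k)) (r (b k)))
    (K : Type) [TopologicalSpace K] [CompactSpace K] [T2Space K] (a : K → A') (b : K → B')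
    (ha : Continuous a) (hb : Continuous b) : Continuous fun k => f (a k) (b k) := by
  have h1 : ∀ (S : Type) [TopologicalSpace S] [CompactSpace S] [T2Space S] (c : S → A') (b : S → B),
      Continuous c → Continuous b → Continuous fun k => f (c k) (r (b k)) := by
    intro S _ _ _ c b hc hb
    have h2 : Continuous fun z : A × S => f (q z.1) (r (b z.2)) :=
      continuous_prod_of_compact (fun x s => f (q x) (r (b s)))
        (fun S' _ _ _ a' s' ha' hs' => h S' a' (fun k => b (s' k)) ha' (hb.comp hs'))
    have h3 : Continuous fun z : A' × S => f z.1 (r (b z.2)) :=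
      hq.continuous_lift_prod_left h2
    exact h3.comp (hc.prodMk continuous_id)
  have h4 : Continuous fun z : B × K => f (a z.2) (r z.1) :=
    continuous_prod_of_compact (fun x s => f (a s) (r x))
      (fun S' _ _ _ b' s' hb' hs' => h1 S' (fun k => a (s' k)) b' (ha.comp hs') hb')
  have h5 : Continuous fun z : B' × K => f (a z.2) z.1 := hr.continuous_lift_prod_left h4
  exact h5.comp (hb.prodMk continuous_id)

/-- The extension of a function of two variables by a constant value on added points. -/
def sumPair {A B W : Type} (m : A → B → W) (w : W) : A ⊕ Unit → B ⊕ Unit → W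
  | Sum.inl x, Sum.inl y => m x y
  | _, _ => w

theorem continuous_sumPair {A B W : Type} [TopologicalSpace A] [TopologicalSpace B]
    [TopologicalSpace W] (m : A → B → W) (w : W)
    (h : ∀ (K : Type) [TopologicalSpace K] [CompactSpace K] [T2Space K] (a : K → A) (b : K → B),
      Continuous a → Continuous b → Continuous fun k => m (a k) (b k))
    (K : Type) [TopologicalSpace K] [CompactSpace K] [T2Space K] (a : K → A ⊕ Unit)
    (b : K → B ⊕ Unit) (ha : Continuous a) (hb : Continuous b) :
    Continuous fun k => sumPair m w (a k) (b k) := by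
  let K1 : Set K := a ⁻¹' range Sum.inl ∩ b ⁻¹' range Sum.inl
  have hop : IsOpen K1 :=
    (isOpen_range_inl.preimage ha).inter (isOpen_range_inl.preimage hb)
  have hcl : IsClosed K1 :=
    (isClosed_range_inl.preimage ha).inter (isClosed_range_inl.preimage hb)
  have hc : CompactSpace K1 := isCompact_iff_compactSpace.1 hcl.isCompact
  have ea : ∀ k : K1, ∃ x, a k = Sum.inl x := fun k => by
    obtain ⟨x, hx⟩ := k.2.1; exact ⟨x, hx.symm⟩
  have eb : ∀ k : K1, ∃ x, b k = Sum.inl x := fun k => by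
    obtain ⟨x, hx⟩ := k.2.2; exact ⟨x, hx.symm⟩
  choose a' ha' using ea
  choose b' hb' using eb
  have hca : Continuous a' := by
    rw [(IsEmbedding.inl (X := A) (Y := Unit)).continuous_iff]
    exact (ha.comp continuous_subtype_val).congr ha'
  have hcb : Continuous b' := by
    rw [(IsEmbedding.inl (X := B) (Y := Unit)).continuous_iff]
    exact (hb.comp continuous_subtype_val).congr hb'
  rw [← continuousOn_univ, ← union_compl_self K1]
  apply ContinuousOn.union_of_isOpen _ _ hop hcl.isOpen_compl
  · rw [continuousOn_iff_continuous_domRestrict]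
    refine (h K1 a' b' hca hcb).congr fun k => ?_
    simp [Set.domRestrict, ha', hb', sumPair]
  · refine (continuousOn_const (c := w)).congr fun k hk => ?_
    have hk' : ¬ (k ∈ K1) := hk
    rcases h1 : a k with x | _ <;> rcases h2 : b k with y | _
    · exact absurd ⟨⟨x, h1.symm⟩, ⟨y, h2.symm⟩⟩ hk'
    all_goals simp [sumPair, h1, h2]

end pairing

/-- The pairing `|X|/|A| × |Y|/|B| → |X × Y| / |A × Y ∪ X × B|`. -/
noncomputable def lpair {P Q : CPair} (x : LObj P) (y : LObj Q) : LObj (P.prod Q) :=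
  Quotient.liftOn₂ x y
    (sumPair (fun x y => lmk (P := P.prod Q) (realPair x y)) (LObj (P.prod Q)).pt) (by
    have hl : ∀ a ∈ LSub P, ∀ b, sumPair (fun x y => lmk (P := P.prod Q) (realPair x y))
        (LObj (P.prod Q)).pt a b = (LObj (P.prod Q)).pt := by
      rintro a (⟨_, ⟨x, rfl⟩, rfl⟩ | rfl) (y | _)
      · simp only [sumPair]
        rw [← realMap_id y, ← realMap_realPair]
        exact lmk_eq_pt_of_mapsTo (P := P.prod Q) _ (fun z => Or.inl z.1.2) _
      all_goals rfl
    have hr : ∀ b ∈ LSub Q, ∀ a, sumPair (fun x y => lmk (P := P.prod Q) (realPair x y))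
        (LObj (P.prod Q)).pt a b = (LObj (P.prod Q)).pt := by
      rintro b (⟨_, ⟨y, rfl⟩, rfl⟩ | rfl) (x | _)
      · simp only [sumPair]
        rw [← realMap_id x, ← realMap_realPair]
        exact lmk_eq_pt_of_mapsTo (P := P.prod Q) _ (fun z => Or.inr z.2.2) _
      all_goals rfl
    rintro a b a' b' (rfl | ⟨ha, ha'⟩) (rfl | ⟨hb, hb'⟩)
    · rfl
    · rw [hr b hb, hr b' hb']
    · rw [hl a ha, hl a' ha']
    · rw [hl a ha, hl a' ha'])

theorem lpair_lmk {P Q : CPair} (x : SingReal P) (y : SingReal Q) :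
    lpair (lmk x : LObj P) (lmk y : LObj Q) = lmk (P := P.prod Q) (realPair x y) := rfl

theorem lpair_pt_left {P Q : CPair} (y : LObj Q) :
    lpair (LObj P).pt y = (LObj (P.prod Q)).pt := by
  induction y using Quotient.inductionOn with
  | _ b => rfl

theorem lpair_pt_right {P Q : CPair} (x : LObj P) :
    lpair x (LObj Q).pt = (LObj (P.prod Q)).pt := by
  induction x using Quotient.inductionOn with
  | _ a => rcases a with x | _ <;> rfl

/-- The pairing `ω_L : L(X, A) ∧ L(Y, B) → L((X, A) × (Y, B))`. -/
noncomputable def ωL (P Q : CPair) : smash (LObj P) (LObj Q) ⟶ LObj (P.prod Q) :=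
  smashLift lpair lpair_pt_left lpair_pt_right (by
    apply continuous_of_quotients (A := SingReal P ⊕ Unit) (B := SingReal Q ⊕ Unit)
      isQuotientMap_quotient_mk' isQuotientMap_quotient_mk'
    apply continuous_sumPair
    intro K _ _ _ a b ha hb
    exact continuous_lmk.comp (continuous_realPair ha hb))

end RefinedTransfer
/-! ### Multiplicative functors -/
namespace RefinedTransfer
open scoped unitInterval

/-- The canonical map `X → |X|` (not continuous): a point as a singular `0`-simplex. -/
noncomputable def vertex {X : Type} [TopologicalSpace X] (x : X) : SingReal X :=
  scell (ContinuousMap.const (stdSimplex ℝ (Fin 1)) x) (stdSimplex.vertex 0)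

/-- The canonical continuous map `I → |I|`, given by the singular simplex `Δ₁ = I`. -/
noncomputable def intervalMap (t : I) : SingReal I :=
  scell (stdSimplexHomeomorphUnitInterval : C(stdSimplex ℝ (Fin 2), I))
    (stdSimplexHomeomorphUnitInterval.symm t)

theorem continuous_intervalMap : Continuous intervalMap :=
  (continuous_scell _).comp stdSimplexHomeomorphUnitInterval.symm.continuous

theorem realMap_vertex {X Y : Type} [TopologicalSpace X] [TopologicalSpace Y] (f : C(X, Y)) (x : X) :
    realMap f (vertex x) = vertex (f x) := realMap_scell _ _ _

theorem scell_vertex {X : Type} [TopologicalSpace X] {n : ℕ}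
    (s : C(stdSimplex ℝ (Fin (n + 1)), X)) (i : Fin (n + 1)) :
    scell s (stdSimplex.vertex i) = vertex (s (stdSimplex.vertex i)) := by
  let f : Fin (0 + 1) →o Fin (n + 1) := ⟨fun _ => i, monotone_const⟩
  have h := scell_affineMap s f (stdSimplex.vertex 0)
  rw [stdSimplex.map_vertex] at h
  refine h.symm.trans ?_
  unfold vertex
  congr 1
  ext w
  have : w = stdSimplex.vertex (0 : Fin 1) := Subsingleton.elim (α := stdSimplex ℝ (Fin 1)) _ _
  rw [this]
  change s (stdSimplex.map f (stdSimplex.vertex 0)) = _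
  rw [stdSimplex.map_vertex]
  rfl

theorem intervalMap_zero : intervalMap 0 = vertex 0 := by
  have : stdSimplexHomeomorphUnitInterval.symm 0 = stdSimplex.vertex 0 := by
    rw [Homeomorph.symm_apply_eq]; rfl
  unfold intervalMap
  rw [this, scell_vertex]
  rfl

theorem intervalMap_one : intervalMap 1 = vertex 1 := by
  have : stdSimplexHomeomorphUnitInterval.symm 1 = stdSimplex.vertex 1 := by
    rw [Homeomorph.symm_apply_eq]; rfl
  unfold intervalMap
  rw [this, scell_vertex]
  rfl

/-- The canonical map `ι : I⁺ → L(I)`. -/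
noncomputable def iota : plus I ⟶ LObj (CPair.abs I) where
  toFun :=
    { toFun := Sum.elim (fun t => lmk (P := CPair.abs I) (intervalMap t))
        (fun _ => (LObj (CPair.abs I)).pt)
      continuous_toFun := (continuous_lmk.comp continuous_intervalMap).sumElim continuous_const }
  map_pt := rfl

/-- A multiplicative functor `(F, ω)` from pairs of compact spaces to pointed spaces. -/
structure MultFunctor where
  F : CPair ⥤ PtSpace
  ω : ∀ P Q : CPair, smash (F.obj P) (LFun.obj Q) ⟶ F.obj (P.prod Q)
  natural : ∀ {P P' Q Q' : CPair} (f : P ⟶ P') (g : Q ⟶ Q'),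
    ω P Q ≫ F.map (CPair.prodMap f g) = smashMap (F.map f) (LFun.map g) ≫ ω P' Q'
  /-- `F(X, A) = F(X, A) ∧ L(*) → F((X, A) × *) = F(X, A)` is the identity. -/
  unit : ∀ (P : CPair) (x : F.obj P),
    F.map (CPair.fst P) (ω P CPair.point (tmul x (lmk (P := CPair.point) (vertex ())))) = x
  assoc : ∀ (P Q R : CPair) (x : F.obj P) (y : LFun.obj Q) (z : LFun.obj R),
    F.map (CPair.assoc P Q R) (ω (P.prod Q) R (tmul (ω P Q (tmul x y)) z)) =
      ω P (Q.prod R) (tmul x (ωL Q R (tmul y z)))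

theorem LMap_pt {P Q : CPair} (f : P ⟶ Q) : LMap f (LObj P).pt = (LObj Q).pt := rfl

/-- `L` itself is a multiplicative functor. -/
noncomputable def LMult : MultFunctor where
  F := LFun
  ω := ωL
  natural {P P' Q Q'} f g := by
    apply PtSpace.hom_ext
    intro z
    obtain ⟨x, y, rfl⟩ := exists_tmul z
    change LMap _ (lpair x y) = lpair (LMap f x) (LMap g y)
    change LObj P at x
    change LObj Q at y
    rcases lobj_cases x with ⟨x, rfl⟩ | rfl
    · rcases lobj_cases y with ⟨y, rfl⟩ | rfl
      · simp only [LMap_lmk, lpair_lmk]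
        exact congrArg lmk (realMap_realPair f.toFun g.toFun x y)
      · rw [lpair_pt_right, LMap_pt, LMap_pt, lpair_pt_right]
    · rw [lpair_pt_left, LMap_pt, LMap_pt, lpair_pt_left]
  unit P x := by
    change LMap _ (lpair x _) = x
    change LObj P at x
    rcases lobj_cases x with ⟨x, rfl⟩ | rfl
    · exact congrArg lmk (realMap_fst_realPair x _)
    · rw [lpair_pt_left, LMap_pt]
  assoc P Q R x y z := by
    change LMap _ (lpair (lpair x y) z) = lpair x (lpair y z)
    change LObj P at x
    change LObj Q at y
    change LObj R at z
    rcases lobj_cases x with ⟨x, rfl⟩ | rfl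
    · rcases lobj_cases y with ⟨y, rfl⟩ | rfl
      · rcases lobj_cases z with ⟨z, rfl⟩ | rfl
        · simp only [LMap_lmk, lpair_lmk]
          refine congrArg lmk ?_
          let φ : C((P × Q) × R, P × (Q × R)) := (CPair.assoc P Q R).toFun
          change realMap φ (realPair (realPair x y) z) = realPair x (realPair y z)
          have e1 : ContinuousMap.fst.comp φ = ContinuousMap.fst.comp ContinuousMap.fst := rfl
          have e2 : (ContinuousMap.fst.comp ContinuousMap.snd).comp φ =
            ContinuousMap.snd.comp ContinuousMap.fst := rfl
          have e3 : (ContinuousMap.snd.comp ContinuousMap.snd).comp φ = ContinuousMap.snd := rfl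
          apply realProj_injective
          · rw [← realMap_comp, e1, realMap_comp, realMap_fst_realPair, realMap_fst_realPair,
              realMap_fst_realPair]
          · rw [realMap_snd_realPair]
            apply realProj_injective
            · rw [← realMap_comp, ← realMap_comp, e2, realMap_comp, realMap_fst_realPair,
                realMap_snd_realPair, realMap_fst_realPair]
            · rw [← realMap_comp, ← realMap_comp, e3, realMap_snd_realPair, realMap_snd_realPair]
        · rw [lpair_pt_right, LMap_pt, lpair_pt_right, lpair_pt_right]
      · rw [lpair_pt_right, lpair_pt_left, lpair_pt_left, LMap_pt, lpair_pt_right]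
    · rw [lpair_pt_left, lpair_pt_left, lpair_pt_left, LMap_pt]

namespace MultFunctor
variable (M : MultFunctor)

theorem ω_vertex (P Q : CPair) (x : M.F.obj P) (q : Q) (hQ : Q.sub = ∅) (f : P ⟶ P.prod Q)
    (hf : ∀ p, f.toFun p = (p, q)) :
    M.ω P Q (tmul x (lmk (vertex q))) = M.F.map f x := by
  let g : CPair.point ⟶ Q := ⟨ContinuousMap.const Unit q, fun _ h => h.elim⟩
  have h1 := congrArg (fun k => k (tmul x (lmk (P := CPair.point) (vertex ()))))
    (M.natural (𝟙 P) g)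
  simp only [PtSpace.comp_apply, smashMap_tmul, CategoryTheory.Functor.map_id,
    PtSpace.id_apply] at h1
  have h2 : LFun.map g (lmk (P := CPair.point) (vertex ())) = lmk (vertex q) :=
    congrArg lmk (realMap_vertex g.toFun ())
  refine (congrArg (fun w => M.ω P Q (tmul x w)) h2.symm).trans (h1.symm.trans ?_)
  have h3 : CPair.prodMap (𝟙 P) g = CPair.fst P ≫ f := by
    apply CPair.hom_ext
    rintro ⟨p, u⟩
    exact (hf p).symm
  rw [h3, CategoryTheory.Functor.map_comp, PtSpace.comp_apply, M.unit]

/-- The homotopy `F(P) ∧ I⁺ → F(P) ∧ L(I) → F(P × I) → F(Q)` induced by a homotopy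
`H : P × I → Q`. -/
noncomputable def hatMap {P Q : CPair} (H : P.prod (CPair.abs I) ⟶ Q) :
    smash (M.F.obj P) (plus I) ⟶ M.F.obj Q :=
  smashMap (𝟙 _) iota ≫ M.ω P (CPair.abs I) ≫ M.F.map H

/-- The path of maps from `F(H₀)` to `F(H₁)` induced by a homotopy `H : P × I → Q`. -/
noncomputable def hat {P Q : CPair} (H : P.prod (CPair.abs I) ⟶ Q) :
    MapPath (M.F.map (P.incl 0 ≫ H)) (M.F.map (P.incl 1 ≫ H)) :=
  MapPath.ofSmash (M.hatMap H) _ _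
    (fun x => by
      rw [CategoryTheory.Functor.map_comp]
      simp only [hatMap, PtSpace.comp_apply, smashMap_tmul, PtSpace.id_apply]
      refine congrArg (M.F.map H) ?_
      change M.ω P (CPair.abs I) (tmul x (lmk (P := CPair.abs I) (intervalMap 0))) = _
      rw [intervalMap_zero]
      exact M.ω_vertex P (CPair.abs I) x (0 : I) rfl (P.incl 0) (fun _ => rfl))
    (fun x => by
      rw [CategoryTheory.Functor.map_comp]
      simp only [hatMap, PtSpace.comp_apply, smashMap_tmul, PtSpace.id_apply]
      refine congrArg (M.F.map H) ?_
      change M.ω P (CPair.abs I) (tmul x (lmk (P := CPair.abs I) (intervalMap 1))) = _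
      rw [intervalMap_one]
      exact M.ω_vertex P (CPair.abs I) x (1 : I) rfl (P.incl 1) (fun _ => rfl))
end MultFunctor
end RefinedTransfer
/-! ### Fiberwise smooth bundles -/
namespace RefinedTransfer
open scoped Manifold ContDiff

/-- The half space `{x ∈ ℝⁿ | x₀ ≥ 0}` (a point, if `n = 0`). -/
def HalfSpace (n : ℕ) : Type := {x : EuclideanSpace ℝ (Fin n) // ∀ i : Fin n, (i : ℕ) = 0 → 0 ≤ x i}

instance (n : ℕ) : TopologicalSpace (HalfSpace n) :=
  inferInstanceAs (TopologicalSpace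
    {x : EuclideanSpace ℝ (Fin n) // ∀ i : Fin n, (i : ℕ) = 0 → 0 ≤ x i})

/-- The retraction of `ℝⁿ` to the half space. -/
noncomputable def halfRetract (n : ℕ) (x : EuclideanSpace ℝ (Fin n)) : HalfSpace n :=
  ⟨WithLp.toLp 2 fun i => if (i : ℕ) = 0 then max (x i) 0 else x i, fun i hi => by simp [hi]⟩

theorem halfRetract_of_mem (n : ℕ) (x : EuclideanSpace ℝ (Fin n))
    (hx : ∀ i : Fin n, (i : ℕ) = 0 → 0 ≤ x i) : (halfRetract n x).1 = x := by
  ext i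
  by_cases h : (i : ℕ) = 0
  · simp [halfRetract, h, hx i h]
  · simp [halfRetract, h]

/-- The model of smooth `n`-dimensional manifolds with boundary. -/
noncomputable def halfModel (n : ℕ) : ModelWithCorners ℝ (EuclideanSpace ℝ (Fin n)) (HalfSpace n) where
  toFun := Subtype.val
  invFun := halfRetract n
  source := univ
  target := {x | ∀ i : Fin n, (i : ℕ) = 0 → 0 ≤ x i}
  map_source' x _ := x.2
  map_target' _ _ := mem_univ _
  left_inv' x _ := Subtype.ext (halfRetract_of_mem n x.1 x.2)
  right_inv' x hx := halfRetract_of_mem n x hx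
  source_eq := rfl
  convex_range' := by
    simp only [instIsRCLikeNormedField, ↓reduceDIte]
    apply Convex.convex_isRCLikeNormedField
    have key : Convex ℝ {x : EuclideanSpace ℝ (Fin n) | ∀ i : Fin n, (i : ℕ) = 0 → 0 ≤ x i} := by
      intro x hx y hy a b ha hb _ i hi
      have h1 := mul_nonneg ha (hx i hi)
      have h2 := mul_nonneg hb (hy i hi)
      simpa using add_nonneg h1 h2
    exact Eq.mpr (congrArg (Convex ℝ) Subtype.range_val) key
  nonempty_interior' := by
    have key : (interior {x : EuclideanSpace ℝ (Fin n) |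
        ∀ i : Fin n, (i : ℕ) = 0 → 0 ≤ x i}).Nonempty := by
      refine ⟨WithLp.toLp 2 fun _ => 1, mem_interior.2
        ⟨{x | ∀ i : Fin n, 0 < x i}, fun x hx i _ => (hx i).le, ?_, fun i => by simp⟩⟩
      have h : {x : EuclideanSpace ℝ (Fin n) | ∀ i : Fin n, 0 < x i} =
          ⋂ i : Fin n, {x | 0 < x i} := by
        ext x
        simp
      rw [h]
      exact isOpen_iInter_of_finite fun i =>
        isOpen_lt continuous_const (PiLp.continuous_apply 2 _ i)
    exact Eq.mpr (congrArg (fun s => (interior s).Nonempty) Subtype.range_val) key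
  continuous_toFun := continuous_subtype_val
  continuous_invFun := by
    apply Continuous.subtype_mk
    apply (PiLp.continuous_toLp 2 _).comp
    apply continuous_pi
    intro i
    have h := PiLp.continuous_apply 2 (fun _ : Fin n => ℝ) i
    by_cases hi : (i : ℕ) = 0
    · simp only [hi, if_true]
      exact h.max continuous_const
    · simp only [hi, if_false]
      exact h

/-- A compact smooth manifold, possibly with boundary. -/
structure CMfd where
  dim : ℕ
  carrier : Type
  [top : TopologicalSpace carrier]
  [charted : ChartedSpace (HalfSpace dim) carrier]
  [smooth : IsManifold (halfModel dim) ∞ carrier]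
  [compact : CompactSpace carrier]
  [t2 : T2Space carrier]

namespace CMfd
instance : CoeSort CMfd Type := ⟨CMfd.carrier⟩
instance (M : CMfd) : TopologicalSpace M := M.top
instance (M : CMfd) : ChartedSpace (HalfSpace M.dim) M := M.charted
instance (M : CMfd) : IsManifold (halfModel M.dim) ∞ M := M.smooth
instance (M : CMfd) : CompactSpace M := M.compact
instance (M : CMfd) : T2Space M := M.t2

/-- The model space of a manifold. -/
noncomputable abbrev model (M : CMfd) : ModelWithCorners ℝ (EuclideanSpace ℝ (Fin M.dim)) (HalfSpace M.dim) :=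
  halfModel M.dim

/-- Smooth diffeomorphisms. -/
abbrev Diffeo (M M' : CMfd) : Type := Diffeomorph M.model M'.model M M' ∞
end CMfd

section vsmooth
variable {P Q : Type} [TopologicalSpace P] [TopologicalSpace Q] {M M' M'' : CMfd}

/-- A family of maps of manifolds, read in charts at a point. -/
noncomputable def chartRep (f : P × M → M') (q : P × M)
    (z : P × EuclideanSpace ℝ (Fin M.dim)) : EuclideanSpace ℝ (Fin M'.dim) :=
  extChartAt M'.model (f q) (f (z.1, (extChartAt M.model q.2).symm z.2))

/-- The maps `f(p, ·)` form, near the point `q`, a family of smooth maps which is continuous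
in `p` in the topology of local uniform convergence of all derivatives: in charts, the maps are
smooth, and each of the iterated derivatives in the direction of the manifold is
jointly continuous. -/
def VSmoothAt (f : P × M → M') (q : P × M) : Prop :=
  ContinuousAt f q ∧ ∃ V ∈ 𝓝 q.1, ∃ W ∈ 𝓝[range M.model] (extChartAt M.model q.2 q.2),
    ∃ τ : P → EuclideanSpace ℝ (Fin M.dim) →
      FormalMultilinearSeries ℝ (EuclideanSpace ℝ (Fin M.dim)) (EuclideanSpace ℝ (Fin M'.dim)),
      (∀ p ∈ V, HasFTaylorSeriesUpToOn ∞ (fun x => chartRep f q (p, x)) (τ p) W) ∧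
      ∀ k, ContinuousOn (fun z : P × EuclideanSpace ℝ (Fin M.dim) => τ z.1 z.2 k) (V ×ˢ W)

theorem eventually_symm {q : P × M} {p : P × M → Prop} (h : ∀ᶠ z in 𝓝 q, p z) :
    ∀ᶠ z in 𝓝 q.1 ×ˢ 𝓝 (extChartAt M.model q.2 q.2),
      p (z.1, (extChartAt M.model q.2).symm z.2) := by
  have h1 : Filter.Tendsto (fun z : P × EuclideanSpace ℝ (Fin M.dim) =>
      (z.1, (extChartAt M.model q.2).symm z.2))
      (𝓝 q.1 ×ˢ 𝓝 (extChartAt M.model q.2 q.2)) (𝓝 q) := by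
    have h2 : Filter.Tendsto (extChartAt M.model q.2).symm (𝓝 (extChartAt M.model q.2 q.2))
        (𝓝 q.2) := by
      have := continuousAt_extChartAt_symm (I := M.model) q.2
      rwa [ContinuousAt, extChartAt_to_inv] at this
    rw [show (𝓝 q) = 𝓝 q.1 ×ˢ 𝓝 q.2 from nhds_prod_eq]
    exact Filter.Tendsto.prodMap Filter.tendsto_id h2
  exact h1.eventually h

theorem VSmoothAt.congr {f g : P × M → M'} {q : P × M} (hf : VSmoothAt f q)
    (h : ∀ᶠ z in 𝓝 q, g z = f z) : VSmoothAt g q := by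
  obtain ⟨hc, V, hV, W, hW, τ, h1, h2⟩ := hf
  obtain ⟨s, hs, t, ht, hst⟩ := Filter.mem_prod_iff.1 (eventually_symm h)
  have hq : g q = f q := h.self_of_nhds
  refine ⟨hc.congr (h.mono fun _ h => h.symm), V ∩ s, Filter.inter_mem hV hs, W ∩ t,
    Filter.inter_mem hW (mem_nhdsWithin_of_mem_nhds ht), τ, fun p hp => ?_, fun k => ?_⟩
  · refine ((h1 p hp.1).mono inter_subset_left).congr fun x hx => ?_
    have h3 : g (p, (extChartAt M.model q.2).symm x) = f (p, (extChartAt M.model q.2).symm x) :=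
      hst (Set.mk_mem_prod hp.2 hx.2)
    simp only [chartRep]
    rw [h3, hq]
  · exact (h2 k).mono (Set.prod_mono inter_subset_left inter_subset_left)

theorem VSmoothAt.pullback {f : Q × M → M'} {h : P → Q} {q : P × M}
    (hf : VSmoothAt f (h q.1, q.2)) (hh : Continuous h) :
    VSmoothAt (fun z : P × M => f (h z.1, z.2)) q := by
  obtain ⟨hc, V, hV, W, hW, τ, h1, h2⟩ := hf
  refine ⟨ContinuousAt.comp (f := fun z : P × M => (h z.1, z.2)) hc (by fun_prop), h ⁻¹' V,
    hh.continuousAt hV, W, hW, fun p => τ (h p), fun p hp => h1 (h p) hp, fun k => ?_⟩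
  exact (h2 k).comp (f := fun z : P × EuclideanSpace ℝ (Fin M.dim) => (h z.1, z.2))
    (by fun_prop) (fun z hz => ⟨hz.1, hz.2⟩)

theorem VSmoothAt.comp {g : P × M' → M''} {f : P × M → M'} {q : P × M}
    (hg : VSmoothAt g (q.1, f q)) (hf : VSmoothAt f q) :
    VSmoothAt (fun z : P × M => g (z.1, f z)) q := by
  obtain ⟨hc, V, hV, W, hW, τ, h1, h2⟩ := hf
  obtain ⟨hc', V', hV', W', hW', τ', h1', h2'⟩ := hg
  have hsrc : ∀ᶠ z in 𝓝 q, f z ∈ (extChartAt M'.model (f q)).source :=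
    hc (extChartAt_source_mem_nhds (I := M'.model) (f q))
  have hmem : ∀ᶠ z in 𝓝 q, extChartAt M'.model (f q) (f z) ∈ W' := by
    have h3 : Filter.Tendsto (fun z => extChartAt M'.model (f q) (f z)) (𝓝 q)
        (𝓝[range M'.model] (extChartAt M'.model (f q) (f q))) := by
      refine tendsto_nhdsWithin_iff.2 ⟨?_, Filter.Eventually.of_forall fun z => mem_range_self _⟩
      exact (continuousAt_extChartAt (I := M'.model) (f q)).tendsto.comp hc
    exact h3.eventually hW'
  obtain ⟨s, hs, t, ht, hst⟩ := Filter.mem_prod_iff.1 (eventually_symm (hsrc.and hmem))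
  have hst' : ∀ p ∈ s, ∀ x ∈ t, _ := fun p hp x hx => hst (Set.mk_mem_prod hp hx)
  refine ⟨?_, V ∩ V' ∩ s, Filter.inter_mem (Filter.inter_mem hV hV') hs, W ∩ t,
    Filter.inter_mem hW (mem_nhdsWithin_of_mem_nhds ht),
    fun p x => (τ' p (chartRep f q (p, x))).taylorComp (τ p x), fun p hp => ?_, fun k => ?_⟩
  · exact ContinuousAt.comp (f := fun z : P × M => (z.1, f z)) hc' (continuousAt_fst.prodMk hc)
  · have h4 := (h1' p hp.1.2).comp ((h1 p hp.1.1).mono (inter_subset_left (t := t)))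
      (fun x hx => (hst' p hp.2 x hx.2).2)
    refine h4.congr fun x hx => ?_
    have h5 := (hst' p hp.2 x hx.2).1
    change extChartAt M''.model (g (q.1, f q)) (g (p, f (p, (extChartAt M.model q.2).symm x))) =
      extChartAt M''.model (g (q.1, f q)) (g (p, (extChartAt M'.model (f q)).symm
        (extChartAt M'.model (f q) (f (p, (extChartAt M.model q.2).symm x)))))
    rw [(extChartAt M'.model (f q)).left_inv h5]
  · have hF : ContinuousOn (chartRep f q) ((V ∩ V' ∩ s) ×ˢ (W ∩ t)) := by
      have h6 := (h2 0).mono (Set.prod_mono (inter_subset_left.trans inter_subset_left)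
        (inter_subset_left) : (V ∩ V' ∩ s) ×ˢ (W ∩ t) ⊆ V ×ˢ W)
      have h7 := (continuousMultilinearCurryFin0 ℝ (EuclideanSpace ℝ (Fin M.dim))
        (EuclideanSpace ℝ (Fin M'.dim))).continuous.comp_continuousOn h6
      refine h7.congr fun z hz => ?_
      exact ((h1 z.1 hz.1.1.1).zero_eq z.2 hz.2.1).symm
    simp only [FormalMultilinearSeries.taylorComp]
    refine continuousOn_finsetSum _ fun c _ => ?_
    let B := c.compAlongOrderedFinpartitionL ℝ (EuclideanSpace ℝ (Fin M.dim))
      (EuclideanSpace ℝ (Fin M'.dim)) (EuclideanSpace ℝ (Fin M''.dim))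
    have hB : Continuous fun w : _ × _ => B w.1 w.2 :=
      continuousOn_univ.1 B.analyticOnNhd_uncurry_of_multilinear.continuousOn
    refine hB.comp_continuousOn (f := fun z : P × EuclideanSpace ℝ (Fin M.dim) =>
      (τ' z.1 (chartRep f q z) c.length, fun m => τ z.1 z.2 (c.partSize m)))
      (ContinuousOn.prodMk ?_ (continuousOn_pi.2 fun m => ?_))
    · exact (h2' c.length).comp (f := fun z : P × EuclideanSpace ℝ (Fin M.dim) =>
        (z.1, chartRep f q z)) (continuousOn_fst.prodMk hF)
        (fun z hz => ⟨hz.1.1.2, (hst' z.1 hz.1.2 z.2 hz.2.2).2⟩)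
    · exact (h2 (c.partSize m)).mono (Set.prod_mono (inter_subset_left.trans inter_subset_left)
        inter_subset_left)

end vsmooth
end RefinedTransfer
/-! ### The category of fiberwise smooth bundles -/
namespace RefinedTransfer
open scoped unitInterval

section
variable {B B' B'' E E' E'' : Type} [TopologicalSpace B] [TopologicalSpace B'] [TopologicalSpace B'']
  [TopologicalSpace E] [TopologicalSpace E'] [TopologicalSpace E''] {M M' M'' : CMfd}
  {p : E → B} {p' : E' → B'} {p'' : E'' → B''}

/-- The expression of a map of total spaces in local trivializations. -/
noncomputable def localRep (φ : Bundle.Trivialization M p) (ψ : Bundle.Trivialization M' p')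
    (f : E → E') (z : B × M) : M' :=
  (ψ (f (φ.toOpenPartialHomeomorph.symm z))).2

/-- In the given local trivializations, the map `f` of total spaces is a diffeomorphism on the fiber
over `b`, and near that fiber it is a continuous family of smooth maps. -/
def FSmoothAt (φ : Bundle.Trivialization M p) (ψ : Bundle.Trivialization M' p') (f : E → E') (b : B) :
    Prop :=
  (∃ d : M.Diffeo M', ∀ m, localRep φ ψ f (b, m) = d m) ∧ ∀ m, VSmoothAt (localRep φ ψ f) (b, m)

theorem localRep_comp (φ : Bundle.Trivialization M p) (ψ : Bundle.Trivialization M' p')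
    (χ : Bundle.Trivialization M'' p'') {f : E → E'} {g : E' → E''} {h : B → B'}
    (hf : ∀ e, p' (f e) = h (p e)) {z : B × M} (hz : z.1 ∈ φ.baseSet) (hz' : h z.1 ∈ ψ.baseSet) :
    localRep φ χ (g ∘ f) z = localRep ψ χ g (h z.1, localRep φ ψ f z) := by
  have h1 : p (φ.toOpenPartialHomeomorph.symm z) = z.1 := φ.proj_symm_apply (φ.mem_target.2 hz)
  have h2 : f (φ.toOpenPartialHomeomorph.symm z) ∈ ψ.source := by
    rw [ψ.mem_source, hf, h1]
    exact hz'
  have h3 : (h z.1, localRep φ ψ f z) = ψ (f (φ.toOpenPartialHomeomorph.symm z)) := by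
    rw [← ψ.mk_proj_snd h2, hf, h1]
    rfl
  rw [h3]
  unfold localRep
  congr 2
  exact congrArg g (ψ.toOpenPartialHomeomorph.left_inv h2).symm

theorem FSmoothAt.comp {φ : Bundle.Trivialization M p} {ψ : Bundle.Trivialization M' p'}
    {χ : Bundle.Trivialization M'' p''} {f : E → E'} {g : E' → E''} {h : B → B'} {b : B}
    (hg : FSmoothAt ψ χ g (h b)) (hf : FSmoothAt φ ψ f b) (hh : Continuous h)
    (hp : ∀ e, p' (f e) = h (p e)) (hb : b ∈ φ.baseSet) (hb' : h b ∈ ψ.baseSet) :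
    FSmoothAt φ χ (g ∘ f) b := by
  obtain ⟨⟨d, hd⟩, hf⟩ := hf
  obtain ⟨⟨d', hd'⟩, hg⟩ := hg
  refine ⟨⟨d.trans d', fun m => ?_⟩, fun m => ?_⟩
  · rw [localRep_comp φ ψ χ hp hb hb']
    simp only [hd, hd']
    rfl
  · have h1 : VSmoothAt (fun z : B × M' => localRep ψ χ g (h z.1, z.2)) (b, localRep φ ψ f (b, m)) :=
      (hg _).pullback (q := (b, localRep φ ψ f (b, m))) hh
    refine (VSmoothAt.comp (q := (b, m)) h1 (hf m)).congr ?_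
    have h2 : ∀ᶠ z : B × M in 𝓝 (b, m), z.1 ∈ φ.baseSet ∧ h z.1 ∈ ψ.baseSet :=
      ((φ.open_baseSet.preimage continuous_fst).inter
        (ψ.open_baseSet.preimage (hh.comp continuous_fst))).mem_nhds ⟨hb, hb'⟩
    exact h2.mono fun z hz => localRep_comp φ ψ χ hp hz.1 hz.2

/-- The product of a local trivialization with a space. -/
def prodTriv (φ : Bundle.Trivialization M p) (X : Type) [TopologicalSpace X] :
    Bundle.Trivialization M (fun z : E × X => (p z.1, z.2)) where
  toFun z := (((φ z.1).1, z.2), (φ z.1).2)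
  invFun z := (φ.toOpenPartialHomeomorph.symm (z.1.1, z.2), z.1.2)
  source := Prod.fst ⁻¹' φ.source
  target := {z | z.1.1 ∈ φ.baseSet}
  map_source' z hz := by
    change (φ z.1).1 ∈ φ.baseSet
    rw [φ.coe_fst hz]
    exact φ.mem_source.1 hz
  map_target' z hz := φ.map_target (φ.mem_target.2 hz)
  left_inv' z hz := Prod.ext (φ.toOpenPartialHomeomorph.left_inv hz) rfl
  right_inv' z hz := by
    have h := φ.apply_symm_apply (x := (z.1.1, z.2)) (φ.mem_target.2 hz)
    simp only [h]
  open_source := φ.open_source.preimage continuous_fst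
  open_target := φ.open_baseSet.preimage (continuous_fst.comp continuous_fst)
  continuousOn_toFun := by
    have h : ContinuousOn (fun z : E × X => φ z.1) (Prod.fst ⁻¹' φ.source) :=
      φ.continuousOn_toFun.comp continuousOn_fst (fun z hz => hz)
    exact (h.fst.prodMk continuousOn_snd).prodMk h.snd
  continuousOn_invFun := by
    refine ContinuousOn.prodMk ?_ (continuous_snd.comp continuous_fst).continuousOn
    exact φ.toOpenPartialHomeomorph.continuousOn_symm.comp
      (f := fun z : (B × X) × M => (z.1.1, z.2)) (by fun_prop) (fun z hz => φ.mem_target.2 hz)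
  baseSet := Prod.fst ⁻¹' φ.baseSet
  open_baseSet := φ.open_baseSet.preimage continuous_fst
  source_eq := by
    ext z
    exact φ.mem_source
  target_eq := by
    ext z
    exact ⟨fun h => ⟨h, trivial⟩, fun h => h.1⟩
  proj_toFun z hz := Prod.ext (φ.coe_fst hz) rfl

theorem FSmoothAt.prod {φ : Bundle.Trivialization M p} {ψ : Bundle.Trivialization M' p'}
    {f : E → E'} {X Y : Type} [TopologicalSpace X] [TopologicalSpace Y] {k : X → Y} {b : B × X}
    (hf : FSmoothAt φ ψ f b.1) :
    FSmoothAt (prodTriv φ X) (prodTriv ψ Y) (Prod.map f k) b :=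
  ⟨hf.1, fun m => (hf.2 m).pullback (f := localRep φ ψ f) (q := (b, m)) continuous_fst⟩

theorem FSmoothAt.incl {φ : Bundle.Trivialization M p} {ψ : Bundle.Trivialization M' p'}
    {f : E → E'} {X : Type} [TopologicalSpace X] {x : X} {b : B} (hf : FSmoothAt φ ψ f b) :
    FSmoothAt φ (prodTriv ψ X) (fun e => (f e, x)) b := hf
end

/-- A fiberwise smooth bundle `E ↓ (B, A)` over a compact pair: a bundle whose fibers are compact
smooth manifolds, with an atlas of local trivializations whose coordinate changes
are continuous families of diffeomorphisms. -/
structure Bdl where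
  base : CPair
  total : Type
  [top : TopologicalSpace total]
  [compact : CompactSpace total]
  [t2 : T2Space total]
  proj : C(total, base)
  atlas : Set (Σ M : CMfd, Bundle.Trivialization M proj)
  cover : ∀ b, ∃ φ ∈ atlas, b ∈ φ.2.baseSet
  compat : ∀ φ ∈ atlas, ∀ ψ ∈ atlas, ∀ b ∈ φ.2.baseSet, b ∈ ψ.2.baseSet → FSmoothAt φ.2 ψ.2 id b

namespace Bdl
instance (E : Bdl) : TopologicalSpace E.total := E.top
instance (E : Bdl) : CompactSpace E.total := E.compact
instance (E : Bdl) : T2Space E.total := E.t2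

/-- Bundle maps: they cover a map of pairs of the base spaces, and are fiberwise smooth, with
a diffeomorphism on each fiber. These are the fiberwise smooth embeddings for which
`(∅ < E) → (∅ < E')` is an excision on each fiber. -/
@[ext]
structure Hom (E E' : Bdl) where
  base : E.base ⟶ E'.base
  tot : C(E.total, E'.total)
  proj_tot : ∀ e, E'.proj (tot e) = base.toFun (E.proj e)
  smooth : ∀ φ ∈ E.atlas, ∀ ψ ∈ E'.atlas, ∀ b ∈ φ.2.baseSet, base.toFun b ∈ ψ.2.baseSet →
    FSmoothAt φ.2 ψ.2 tot b

instance : Category Bdl where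
  Hom := Hom
  id E :=
    { base := 𝟙 _
      tot := ContinuousMap.id _
      proj_tot := fun _ => rfl
      smooth := E.compat }
  comp {E E' E''} f g :=
    { base := f.base ≫ g.base
      tot := g.tot.comp f.tot
      proj_tot := fun e => (g.proj_tot _).trans (congrArg g.base.toFun (f.proj_tot e))
      smooth := fun φ hφ χ hχ b hb hb' => by
        obtain ⟨ψ, hψ, h⟩ := E'.cover (f.base.toFun b)
        exact (g.smooth ψ hψ χ hχ _ h hb').comp (f.smooth φ hφ ψ hψ b hb h)
          f.base.toFun.continuous f.proj_tot hb h }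

/-- The base `(B, A)` of a bundle. -/
def baseFun : Bdl ⥤ CPair where
  obj E := E.base
  map f := Hom.base f

/-- The pair `(E, E|A)`. -/
def totFun : Bdl ⥤ CPair where
  obj E := ⟨E.total, E.proj ⁻¹' E.base.sub, E.base.closed.preimage E.proj.continuous⟩
  map {E E'} f := ⟨Hom.tot f, fun e he => by
    change E'.proj (Hom.tot f e) ∈ E'.base.sub
    rw [Hom.proj_tot f]
    exact (Hom.base f).mapsTo he⟩

/-- The bundle `E × X ↓ (B, A) × (X, Y)`. -/
def prod (E : Bdl) (P : CPair) : Bdl where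
  base := E.base.prod P
  total := E.total × P
  proj := ⟨fun z => (E.proj z.1, z.2), by fun_prop⟩
  atlas := {φ | ∃ ψ ∈ E.atlas, φ = ⟨ψ.1, prodTriv ψ.2 P⟩}
  cover b := by
    obtain ⟨ψ, hψ, h⟩ := E.cover b.1
    exact ⟨_, ⟨ψ, hψ, rfl⟩, h⟩
  compat := by
    rintro _ ⟨φ, hφ, rfl⟩ _ ⟨ψ, hψ, rfl⟩ b hb hb'
    exact (E.compat φ hφ ψ hψ b.1 hb hb').prod (k := id)

/-- The product functor. -/
def prodFun : Bdl × CPair ⥤ Bdl where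
  obj C := C.1.prod C.2
  map {C D} f :=
    { base := CPair.prodMap (Hom.base f.1) f.2
      tot := (Hom.tot f.1).prodMap f.2.toFun
      proj_tot := fun e => Prod.ext (Hom.proj_tot f.1 e.1) rfl
      smooth := by
        rintro _ ⟨φ, hφ, rfl⟩ _ ⟨ψ, hψ, rfl⟩ b hb hb'
        exact (Hom.smooth f.1 φ hφ ψ hψ b.1 hb hb').prod }

/-- The inclusion `E → E × I` at the parameter `t`. -/
def incl (E : Bdl) (t : I) : E ⟶ E.prod (CPair.abs I) where
  base := E.base.incl t
  tot := ⟨fun e => (e, t), by fun_prop⟩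
  proj_tot _ := rfl
  smooth := by
    rintro φ hφ _ ⟨ψ, hψ, rfl⟩ b hb hb'
    exact (E.compat φ hφ ψ hψ b hb hb').incl
end Bdl
end RefinedTransfer
/-! ### Simplicial transformations -/
namespace RefinedTransfer

/-- A simplicial transformation `F → G` on the nerve of a category: for each
`σ = (C₀ → ⋯ → C_p)` a map `F(C₀) ∧ Δ_p⁺ → G(C_p)`, compatible with the simplicial operators. -/
structure SimplTrans {C : Type 1} [Category.{0} C] (F G : C ⥤ PtSpace) where
  app : ∀ {p : ℕ} (σ : ComposableArrows C p),
    smash (F.obj (σ.obj 0)) (plus (stdSimplex ℝ (Fin (p + 1)))) ⟶ G.obj (σ.obj (Fin.last p))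
  natural : ∀ {p q : ℕ} (σ : ComposableArrows C p) (α : Fin (q + 1) →o Fin (p + 1)),
    smashMap (𝟙 (F.obj (σ.obj 0))) (plusMap (affineMap α)) ≫ app σ =
      smashMap (F.map (σ.map (homOfLE (Fin.zero_le (α 0))))) (𝟙 _) ≫
        app (p := q) (α.monotone.functor ⋙ σ) ≫ G.map (σ.map (homOfLE (Fin.le_last (α (Fin.last q)))))

/-- The inclusion `X → X ∧ K⁺` at a point of `K`. -/
def slice (X : PtSpace) {K : Type} [TopologicalSpace K] [CompactSpace K] [T2Space K] (k : K) :
    X ⟶ smash X (plus K) where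
  toFun := ⟨fun x => tmul x (toPlus k),
    (continuous_tmul_plus X K).comp (continuous_id.prodMk continuous_const)⟩
  map_pt := tmul_eq_pt _ _ (Or.inl rfl)

namespace SimplTrans
variable {C : Type 1} [Category.{0} C] {F G : C ⥤ PtSpace} (T : SimplTrans F G)

/-- The map `T(C) : F(C) → G(C)`. -/
noncomputable def obj (X : C) : F.obj X ⟶ G.obj X :=
  slice _ (stdSimplex.vertex 0) ≫ T.app (ComposableArrows.mk₀ X)

theorem app_vertex {p : ℕ} (σ : ComposableArrows C p) (i : Fin (p + 1)) (x : F.obj (σ.obj 0)) :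
    T.app σ (tmul x (toPlus (stdSimplex.vertex i))) =
      G.map (σ.map (homOfLE (Fin.le_last i)))
        (T.obj (σ.obj i) (F.map (σ.map (homOfLE (Fin.zero_le i))) x)) := by
  let α : Fin (0 + 1) →o Fin (p + 1) := ⟨fun _ => i, monotone_const⟩
  have h := congrArg (fun k => k (tmul x (toPlus (stdSimplex.vertex 0)))) (T.natural σ α)
  have h1 : affineMap α (stdSimplex.vertex 0) = stdSimplex.vertex i := stdSimplex.map_vertex _ _
  have key : ∀ τ : ComposableArrows C 0, ∀ y : F.obj (τ.obj 0),
      T.app τ (tmul y (toPlus (stdSimplex.vertex 0))) = T.obj (τ.obj 0) y := by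
    intro τ
    obtain ⟨X, rfl⟩ := ComposableArrows.mk₀_surjective τ
    intro y
    rfl
  have h2 := key (α.monotone.functor ⋙ σ) (F.map (σ.map (homOfLE (Fin.zero_le i))) x)
  have h3 : T.app σ (tmul x (toPlus (affineMap α (stdSimplex.vertex 0)))) =
      G.map (σ.map (homOfLE (Fin.le_last i))) (T.app (p := 0) (α.monotone.functor ⋙ σ)
        (tmul (F.map (σ.map (homOfLE (Fin.zero_le i))) x) (toPlus (stdSimplex.vertex 0)))) := h
  rw [h1] at h3
  rw [h3]
  exact congrArg _ h2

/-- The path `T(φ)` from `G(φ) T(C₀)` to `T(C₁) F(φ)`, for an arrow `φ : C₀ → C₁`; here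
`Δ₁ = I`. -/
noncomputable def path {X Y : C} (φ : X ⟶ Y) :
    MapPath (T.obj X ≫ G.map φ) (F.map φ ≫ T.obj Y) :=
  MapPath.ofSmash
    (smashMap (𝟙 (F.obj X)) (plusMap (stdSimplexHomeomorphUnitInterval.symm :
      C(unitInterval, stdSimplex ℝ (Fin 2)))) ≫ T.app (ComposableArrows.mk₁ φ)) _ _
    (fun x => by
      have h : stdSimplexHomeomorphUnitInterval.symm 0 = stdSimplex.vertex (0 : Fin 2) := by
        rw [Homeomorph.symm_apply_eq]; rfl
      have h1 := T.app_vertex (ComposableArrows.mk₁ φ) 0 x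
      change T.app (ComposableArrows.mk₁ φ)
        (tmul x (toPlus (stdSimplexHomeomorphUnitInterval.symm 0))) = _
      rw [h]
      refine h1.trans ?_
      change G.map φ (T.obj X (F.map (𝟙 X) x)) = G.map φ (T.obj X x)
      rw [F.map_id]
      rfl)
    (fun x => by
      have h : stdSimplexHomeomorphUnitInterval.symm 1 = stdSimplex.vertex (1 : Fin 2) := by
        rw [Homeomorph.symm_apply_eq]; rfl
      have h1 := T.app_vertex (ComposableArrows.mk₁ φ) 1 x
      change T.app (ComposableArrows.mk₁ φ)
        (tmul x (toPlus (stdSimplexHomeomorphUnitInterval.symm 1))) = _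
      rw [h]
      refine h1.trans ?_
      change G.map (𝟙 Y) (T.obj Y (F.map φ x)) = T.obj Y (F.map φ x)
      rw [G.map_id]
      rfl)
end SimplTrans

/-- The functor `F ∧ G` on a product of categories. -/
noncomputable def smashFun {C D : Type 1} [Category.{0} C] [Category.{0} D] (F : C ⥤ PtSpace)
    (G : D ⥤ PtSpace) : C × D ⥤ PtSpace where
  obj X := smash (F.obj X.1) (G.obj X.2)
  map f := smashMap (F.map f.1) (G.map f.2)
  map_id X := by
    apply PtSpace.hom_ext
    intro z
    obtain ⟨x, y, rfl⟩ := exists_tmul z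
    simp
  map_comp f g := by
    apply PtSpace.hom_ext
    intro z
    obtain ⟨x, y, rfl⟩ := exists_tmul z
    simp

/-- The functor `F ∧ I⁺`. -/
noncomputable def smashI {C : Type 1} [Category.{0} C] (F : C ⥤ PtSpace) : C ⥤ PtSpace where
  obj X := smash (F.obj X) (plus unitInterval)
  map f := smashMap (F.map f) (𝟙 _)
  map_id X := by
    apply PtSpace.hom_ext
    intro z
    obtain ⟨x, y, rfl⟩ := exists_tmul z
    simp
  map_comp f g := by
    apply PtSpace.hom_ext
    intro z
    obtain ⟨x, y, rfl⟩ := exists_tmul z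
    simp

/-- The functor `E ↓ (B, A) ↦ L(B, A)`. -/
noncomputable def LBase : Bdl ⥤ PtSpace := Bdl.baseFun ⋙ LFun

/-- The functor `E ↓ (B, A) ↦ F(E, E|A)`. -/
noncomputable def FTot (M : MultFunctor) : Bdl ⥤ PtSpace := Bdl.totFun ⋙ M.F

/-- A multiplicative homotopy for a simplicial transformation `T : L → F` on the nerve of the
category of fiberwise smooth bundles: a simplicial homotopy `μ : L ∧ L ∧ I⁺ → F^×`, on the product
of the category of bundles with the category of compact pairs, from `ω_F (T ∧ 1)` to `T^× ω_L`,
which is constant when all the compact pairs are one point spaces. -/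
structure MultHomotopy (M : MultFunctor) (T : SimplTrans LBase (FTot M)) where
  μ : SimplTrans (smashI (smashFun LBase LFun)) (Bdl.prodFun ⋙ FTot M)
  zero : ∀ {p : ℕ} (σ : ComposableArrows (Bdl × CPair) p) (x : LBase.obj (σ.obj 0).1)
    (y : LFun.obj (σ.obj 0).2) (s : stdSimplex ℝ (Fin (p + 1))),
    μ.app σ (tmul (tmul (tmul x y) (toPlus (0 : unitInterval))) (toPlus s)) =
      M.ω (Bdl.totFun.obj (σ.obj (Fin.last p)).1) (σ.obj (Fin.last p)).2
        (tmul (T.app (p := p) (σ ⋙ CategoryTheory.Prod.fst _ _) (tmul x (toPlus s)))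
          (LFun.map (σ.map (homOfLE (Fin.zero_le (Fin.last p)))).2 y))
  one : ∀ {p : ℕ} (σ : ComposableArrows (Bdl × CPair) p) (x : LBase.obj (σ.obj 0).1)
    (y : LFun.obj (σ.obj 0).2) (s : stdSimplex ℝ (Fin (p + 1))),
    μ.app σ (tmul (tmul (tmul x y) (toPlus (1 : unitInterval))) (toPlus s)) =
      T.app (p := p) (σ ⋙ Bdl.prodFun)
        (tmul (ωL (σ.obj 0).1.base (σ.obj 0).2 (tmul x y)) (toPlus s))
  normal : ∀ {p : ℕ} (σ : ComposableArrows (Bdl × CPair) p),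
    (∀ i, (σ.obj i).2.sub = ∅ ∧ Nonempty (Unique (σ.obj i).2)) →
    ∀ (x : LBase.obj (σ.obj 0).1) (y : LFun.obj (σ.obj 0).2) (s : stdSimplex ℝ (Fin (p + 1)))
      (t t' : unitInterval),
      μ.app σ (tmul (tmul (tmul x y) (toPlus t)) (toPlus s)) =
        μ.app σ (tmul (tmul (tmul x y) (toPlus t')) (toPlus s))

end RefinedTransfer

open RefinedTransfer

/-! ### Homotopies of paths from maps of squares and triangles -/
namespace RefinedTransfer
open scoped unitInterval

section
variable {D Z : Type*} [TopologicalSpace D] [TopologicalSpace Z]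

/-! Write `*` for the one point pair, `v` for the vertex of `L(*)`, and let `j` be 0 or 1. The
inclusion `E → E × I` at `j` is not a product arrow, so multiplicativity says nothing about it
directly. It is replaced by the product `E × * → E × I` of the identity of `E` with the inclusion of
`j`. The target `E'` is replaced by `E' × *`, so that the composite `E × * → E × I → E' × *` is the
product of `h_j` with the identity of `*`. Since `μ` is constant over one point pairs and `ω_F` is
unital, the transfer of such a product, restricted along `x ↦ ω_L(x ∧ v)` and projected back to
`F(E')`, is the transfer of `h_j` itself (`app_prod_point`, `obj_prod_point`).

The square of the theorem is then filled in the space of pointed maps `L(B, A) → F(E', E'|A')`. The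
middle consists of two squares, one above the other. The homotopy `μ` on `(E, I)`, followed by
`F(H)`, leads from the path induced on `F` to `F(H) T(E × I) ω_L` (`homotopySquare`). The transfer
of the arrow `E × I → E' × *` leads from there to the path induced on `L` (`arrowSquare`).

At each end `j` the outer side of the two squares has to be compared with the path of `h_j`. The
transfer of the 2-simplex above is a triangle (`endTriangle`). Its long edge is the path of `h_j`,
its last edge is the side of `arrowSquare`, and its first edge comes from the arrow `E × * → E × I`.
The homotopy `μ` on that arrow (`endSquare`) connects this first edge with the side of
`homotopySquare`. The two remaining sides of `endSquare` are constant: one because `T` of an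
identity arrow is a constant path, the other because `μ` is constant over one point pairs.

Squares and simplices are contractible, so each filler yields a homotopy of paths, and
`prism_homotopic` pastes them. Finally `sameClass_trans` turns a homotopy of paths of maps into a
base point preserving homotopy relative to the end points. -/

/-- Two paths which factor through paths with the same end points in a simply connected space are
homotopic. -/
theorem homotopic_of_factor [SimplyConnectedSpace D] (Φ : C(D, Z)) {d d' : D} (γ γ' : Path d d') {a b : Z}
    (p p' : Path a b) (h : ∀ t, Φ (γ t) = p t) (h' : ∀ t, Φ (γ' t) = p' t) : p.Homotopic p' := by
  -- The values at 0 and 1 identify the end points, so that `p` and `p'` become literal images of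
  -- paths in `D`.
  obtain rfl : Φ d = a := by simpa using h 0
  obtain rfl : Φ d' = b := by simpa using h 1
  have e : p = γ.map Φ.continuous := by ext t; exact (h t).symm
  have e' : p' = γ'.map Φ.continuous := by ext t; exact (h' t).symm
  rw [e, e']
  exact (SimplyConnectedSpace.paths_homotopic γ γ').map Φ

theorem trans_factor (Φ : D → Z) {d d' d'' : D} {γ : Path d d'} {γ' : Path d' d''}
    {a b c : Z} {p : Path a b} {p' : Path b c} (h : ∀ t, Φ (γ t) = p t)
    (h' : ∀ t, Φ (γ' t) = p' t) (t : I) : Φ (γ.trans γ' t) = p.trans p' t := by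
  rw [Path.trans_apply, Path.trans_apply]
  split_ifs
  · exact h _
  · exact h' _

theorem triangle_homotopic [SimplyConnectedSpace D] (Φ : C(D, Z)) {d d' d'' : D} (γ : Path d d') (γ' : Path d' d'')
    (γ'' : Path d d'') {a b c : Z} (p : Path a b) (p' : Path b c) (p'' : Path a c)
    (h : ∀ t, Φ (γ t) = p t) (h' : ∀ t, Φ (γ' t) = p' t) (h'' : ∀ t, Φ (γ'' t) = p'' t) :
    p''.Homotopic (p.trans p') :=
  homotopic_of_factor Φ γ'' (γ.trans γ') p'' (p.trans p') h'' (trans_factor Φ h h')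
end

/-- The path in a product of intervals along the first coordinate. -/
def horizontal (u : I) : Path ((0, u) : I × I) (1, u) where
  toFun t := (t, u)
  source' := rfl
  target' := rfl

/-- The path in a product of intervals along the second coordinate. -/
def vertical (t : I) : Path ((t, 0) : I × I) (t, 1) where
  toFun u := (t, u)
  source' := rfl
  target' := rfl

/-- Contractible spaces are simply connected; this and the next instance make `homotopic_of_factor`
applicable to maps out of squares and simplices. -/
instance : ContractibleSpace I := (convex_Icc (0 : ℝ) 1).contractibleSpace ⟨0, by simp⟩

instance (n : ℕ) : ContractibleSpace (stdSimplex ℝ (Fin (n + 1))) :=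
  (convex_stdSimplex ℝ (Fin (n + 1))).contractibleSpace ⟨_, (stdSimplex.vertex 0).2⟩

/-- The edge of a simplex given by a map of vertices. -/
noncomputable def edge {n : ℕ} (α : Fin (1 + 1) →o Fin (n + 1)) :
    Path (stdSimplex.vertex (S := ℝ) (α 0)) (stdSimplex.vertex (α 1)) where
  toFun t := affineMap α (stdSimplexHomeomorphUnitInterval.symm t)
  continuous_toFun := (affineMap α).continuous.comp stdSimplexHomeomorphUnitInterval.symm.continuous
  source' := by
    have h : stdSimplexHomeomorphUnitInterval.symm 0 = stdSimplex.vertex (0 : Fin 2) := by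
      rw [Homeomorph.symm_apply_eq]; rfl
    rw [h]
    exact stdSimplex.map_vertex _ _
  target' := by
    have h : stdSimplexHomeomorphUnitInterval.symm 1 = stdSimplex.vertex (1 : Fin 2) := by
      rw [Homeomorph.symm_apply_eq]; rfl
    rw [h]
    exact stdSimplex.map_vertex _ _

/-! ### Filling squares, triangles and the prism. -/

section
variable {Z : Type*} [TopologicalSpace Z]

/-- The two ways around the boundary of `I × I` from one corner to the opposite one are homotopic in
the square, and `Φ` carries the homotopy to `Z`. -/
theorem square_homotopic (Φ : C(I × I, Z)) {a b c d : Z} (p : Path a b) (q : Path c d)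
    (l : Path a c) (r : Path b d) (hp : ∀ t, Φ (t, 0) = p t) (hq : ∀ t, Φ (t, 1) = q t)
    (hl : ∀ u, Φ (0, u) = l u) (hr : ∀ u, Φ (1, u) = r u) :
    (p.trans r).Homotopic (l.trans q) :=
  homotopic_of_factor Φ ((horizontal 0).trans (vertical 1)) ((vertical 0).trans (horizontal 1))
    _ _ (trans_factor Φ hp hr) (trans_factor Φ hl hq)

/-- The order preserving map `[1] → [2]` with the given values. -/
def edgeMap (i j : Fin (2 + 1)) (h : i ≤ j) : Fin (1 + 1) →o Fin (2 + 1) where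
  toFun := ![i, j]
  monotone' := by
    intro a b hab
    fin_cases a <;> fin_cases b <;> simp_all

theorem simplex_homotopic (Φ : C(stdSimplex ℝ (Fin (2 + 1)), Z)) {a b c : Z} (p : Path a b)
    (q : Path b c) (r : Path a c) (hp : ∀ t, Φ (edge (edgeMap 0 1 (by decide)) t) = p t)
    (hq : ∀ t, Φ (edge (edgeMap 1 2 (by decide)) t) = q t)
    (hr : ∀ t, Φ (edge (edgeMap 0 2 (by decide)) t) = r t) : r.Homotopic (p.trans q) :=
  triangle_homotopic Φ (edge (edgeMap 0 1 (by decide))) (edge (edgeMap 1 2 (by decide)))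
    (edge (edgeMap 0 2 (by decide))) p q r hp hq hr

/-- The square of paths `l 0`, `top`, `bot`, `l 1` commutes up to homotopy, if it is filled in by two
squares `Q` and `Q'`, one above the other, a triangle `Δ j` at each end which relates `l j` with
the path `Q' (j, ·)`, and a square `q j` which relates the remaining edge of it with `Q (j, ·)`. -/
theorem prism_homotopic {a e : I → Z} (bot : Path (a 0) (a 1)) (top : Path (e 0) (e 1))
    (l : ∀ j, Path (a j) (e j)) (Δ : I → C(stdSimplex ℝ (Fin (2 + 1)), Z)) (q : I → C(I × I, Z))
    (Q Q' : C(I × I, Z))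
    (h02 : ∀ j, j = 0 ∨ j = 1 → ∀ s, Δ j (edge (edgeMap 0 2 (by decide)) s) = l j s)
    (h01 : ∀ j, j = 0 ∨ j = 1 → ∀ s, Δ j (edge (edgeMap 0 1 (by decide)) s) = q j (s, 1))
    (h12 : ∀ j, j = 0 ∨ j = 1 → ∀ s, Δ j (edge (edgeMap 1 2 (by decide)) s) = Q' (j, s))
    (hq0 : ∀ j, j = 0 ∨ j = 1 → ∀ s, q j (s, 0) = a j) (hq1 : ∀ j, j = 0 ∨ j = 1 → ∀ u, q j (0, u) = a j)
    (hq2 : ∀ j, j = 0 ∨ j = 1 → ∀ u, q j (1, u) = Q (j, u))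
    (hQ0 : ∀ t, Q (t, 0) = bot t) (hQ1 : ∀ t, Q (t, 1) = Q' (t, 0))
    (hQ2 : ∀ t, Q' (t, 1) = top t) :
    ((l 0).trans top).Homotopic (bot.trans (l 1)) := by
  -- At the end `j` there are two routes from `a j` to the corner `Q (j, 1)`: `A` along the first
  -- edge of the triangle and `M` along the side of `Q`. The path `B` is the side of `Q'`.
  have hm : ∀ j, j = 0 ∨ j = 1 → ∃ (A M : Path (a j) (Q (j, 1))) (B : Path (Q (j, 1)) (e j)),
      (∀ s, q j (s, 1) = A s) ∧ (∀ u, Q (j, u) = M u) ∧ (∀ s, Q' (j, s) = B s) := by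
    intro j hj
    -- Both sides are the value of `Δ j` at the last vertex, reached along the edges 12 and 02.
    have e1 : Q' (j, 1) = e j := by
      rw [← h12 j hj, Path.target, ← (l j).target, ← h02 j hj, Path.target]
      rfl
    exact ⟨⟨⟨fun s => q j (s, 1), by fun_prop⟩, hq1 j hj 1, hq2 j hj 1⟩,
      ⟨⟨fun u => Q (j, u), by fun_prop⟩, (hq2 j hj 0).symm.trans (hq0 j hj 1), rfl⟩,
      ⟨⟨fun s => Q' (j, s), by fun_prop⟩, (hQ1 j).symm, e1⟩,
      fun _ => rfl, fun _ => rfl, fun _ => rfl⟩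
  choose A M B hA hM hB using hm
  -- The triangle replaces `l j` by `A` followed by `B`; the square `q j`, whose bottom and left
  -- sides are constant, replaces `A` by `M`.
  have hl : ∀ j (hj : j = 0 ∨ j = 1), (l j).Homotopic ((M j hj).trans (B j hj)) := by
    intro j hj
    have h1 : (l j).Homotopic ((A j hj).trans (B j hj)) :=
      simplex_homotopic (Δ j) (A j hj) (B j hj) (l j) (fun s => (h01 j hj s).trans (hA j hj s))
        (fun s => (h12 j hj s).trans (hB j hj s)) (h02 j hj)
    have h2 : ((Path.refl (a j)).trans (M j hj)).Homotopic ((Path.refl (a j)).trans (A j hj)) :=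
      square_homotopic (q j) (Path.refl _) (A j hj) (Path.refl _) (M j hj) (hq0 j hj) (hA j hj) (hq1 j hj)
        (fun u => (hq2 j hj u).trans (hM j hj u))
    rw [← Path.Homotopic.Quotient.eq] at h1 h2 ⊢
    simp only [Path.Homotopic.Quotient.mk_trans, Path.Homotopic.Quotient.mk_refl,
      Path.Homotopic.Quotient.refl_trans] at h1 h2 ⊢
    rw [h1, h2]
  -- The common edge of `Q` and `Q'`. In path classes, the rest is: `l 0 · top = M 0 · B 0 · top = M
  -- 0 · mid · B 1 = bot · M 1 · B 1 = bot · l 1`.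
  let mid : Path (Q (0, 1)) (Q (1, 1)) := ⟨⟨fun t => Q (t, 1), by fun_prop⟩, rfl, rfl⟩
  have s1 : (bot.trans (M 1 (Or.inr rfl))).Homotopic ((M 0 (Or.inl rfl)).trans mid) :=
    square_homotopic Q bot mid (M 0 (Or.inl rfl)) (M 1 (Or.inr rfl)) hQ0 (fun _ => rfl) (hM 0 (Or.inl rfl)) (hM 1 (Or.inr rfl))
  have s2 : (mid.trans (B 1 (Or.inr rfl))).Homotopic ((B 0 (Or.inl rfl)).trans top) :=
    square_homotopic Q' mid top (B 0 (Or.inl rfl)) (B 1 (Or.inr rfl)) (fun t => (hQ1 t).symm) hQ2 (hB 0 (Or.inl rfl)) (hB 1 (Or.inr rfl))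
  have l0 := hl 0 (Or.inl rfl)
  have l1 := hl 1 (Or.inr rfl)
  rw [← Path.Homotopic.Quotient.eq] at s1 s2 l0 l1 ⊢
  simp only [Path.Homotopic.Quotient.mk_trans] at s1 s2 l0 l1 ⊢
  rw [l0, l1, Path.Homotopic.Quotient.trans_assoc, ← s2, ← Path.Homotopic.Quotient.trans_assoc,
    ← s1, Path.Homotopic.Quotient.trans_assoc]
end

/-! ### Paths of pointed maps -/
section
variable {X Y : PtSpace}

/-- The space of pointed maps, with the compact open topology. -/
instance : TopologicalSpace (X ⟶ Y) := TopologicalSpace.induced PtSpace.Hom.toFun inferInstance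

/-- A family of pointed maps with parameters in a compact Hausdorff space is continuous if it is
continuous in both variables on compact Hausdorff spaces. -/
def ptFamily {D : Type} [TopologicalSpace D] [CompactSpace D] [T2Space D] (f : D → (X ⟶ Y))
    (h : ∀ (S : Type) [TopologicalSpace S] [CompactSpace S] [T2Space S] (a : S → X) (b : S → D),
      Continuous a → Continuous b → Continuous fun s => f (b s) (a s)) : C(D, X ⟶ Y) where
  toFun := f
  continuous_toFun := by
    rw [continuous_induced_rng]
    apply ContinuousMap.continuous_of_continuous_uncurry
    exact (continuous_prod_of_compact (fun x d => f d x) h).comp continuous_swap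

/-- A path of pointed maps as a path in the space of pointed maps. -/
def MapPath.toPath {f g : X ⟶ Y} (p : MapPath f g) : Path f g where
  toFun t := ⟨⟨fun x => p (t, x), by fun_prop⟩, by
    refine (p.prop t X.pt rfl).trans f.map_pt⟩
  continuous_toFun := by
    rw [continuous_induced_rng]
    apply ContinuousMap.continuous_of_continuous_uncurry
    exact p.continuous
  source' := PtSpace.hom_ext fun x => p.apply_zero x
  target' := PtSpace.hom_ext fun x => p.apply_one x

theorem MapPath.toPath_apply {f g : X ⟶ Y} (p : MapPath f g) (t : I) (x : X) :
    p.toPath t x = p (t, x) := rfl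

/-- Concatenation of relative homotopies and concatenation of paths both switch at parameter one
half with the same rescaling, so this is an equality and not just a homotopy. -/
theorem MapPath.toPath_trans {f g h : X ⟶ Y} (p : MapPath f g) (q : MapPath g h) :
    MapPath.toPath (p.trans q) = p.toPath.trans q.toPath := by
  ext t
  apply PtSpace.hom_ext
  intro x
  rw [MapPath.toPath_apply, Path.trans_apply, ContinuousMap.HomotopyRel.trans_apply]
  split_ifs <;> rfl

/-- Uncurrying a homotopy of paths in the mapping space gives the required homotopy. The base point
is fixed because every stage is a pointed map. -/
theorem MapPath.sameClass_of_homotopic {f g : X ⟶ Y} {p q : MapPath f g}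
    (h : p.toPath.Homotopic q.toPath) : p.SameClass q := by
  obtain ⟨K⟩ := h
  -- Since `X` need not be locally compact, evaluation `C(X, Y) × X → Y` may fail to be continuous.
  -- Because `X` is compactly generated and `I × I` is compact, testing on a compact Hausdorff `S`
  -- suffices, and over `S` uncurrying is harmless.
  have hc : Continuous fun z : X × (I × I) => K z.2 z.1 := by
    apply continuous_prod_of_compact (fun (x : X) (w : I × I) => K w x)
    intro S _ _ _ a b ha hb
    have h1 : Continuous fun s => (K (b s)).toFun.comp ⟨a, ha⟩ :=
      (ContinuousMap.continuous_precomp _).comp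
        (continuous_induced_dom.comp (K.continuous.comp hb))
    exact (ContinuousMap.continuous_uncurry_of_continuous ⟨_, h1⟩).comp
      (continuous_id.prodMk continuous_id)
  exact ⟨{
    toFun := fun z => K (z.1, z.2.1) z.2.2
    continuous_toFun := hc.comp (f := fun z : I × (I × X) => (z.2.2, (z.1, z.2.1))) (by fun_prop)
    map_zero_left := fun z => congrArg (fun k : X ⟶ Y => k z.2) (K.apply_zero z.1)
    map_one_left := fun z => congrArg (fun k : X ⟶ Y => k z.2) (K.apply_one z.1)
    prop' := by
      rintro s ⟨t, x⟩ (h | h | h)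
      · obtain rfl : t = 0 := h
        have e : K (s, 0) = f := K.source s
        exact (congrArg (fun k : X ⟶ Y => k x) e).trans (p.apply_zero x).symm
      · obtain rfl : t = 1 := h
        have e : K (s, 1) = g := K.target s
        exact (congrArg (fun k : X ⟶ Y => k x) e).trans (p.apply_one x).symm
      · obtain rfl : x = X.pt := h
        exact (K (s, t)).map_pt.trans ((p.prop t X.pt rfl).trans f.map_pt).symm }⟩

theorem MapPath.sameClass_trans {f g g' h : X ⟶ Y} {p : MapPath f g} {q : MapPath g h}
    {p' : MapPath f g'} {q' : MapPath g' h}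
    (H : (p.toPath.trans q.toPath).Homotopic (p'.toPath.trans q'.toPath)) :
    MapPath.SameClass (p.trans q) (p'.trans q') := by
  apply MapPath.sameClass_of_homotopic
  rw [MapPath.toPath_trans, MapPath.toPath_trans]
  exact H
end
end RefinedTransfer
/-! ### Simplicial transformations on simplices of low dimension -/
namespace RefinedTransfer
open scoped unitInterval

namespace SimplTrans
variable {C : Type 1} [Category.{0} C] {F G : C ⥤ PtSpace} (T : SimplTrans F G)

/-- The simplicial identity `natural` evaluated at a point; the lemmas on faces and degeneracies
below are its instances. -/
theorem app_affineMap {p q : ℕ} (τ : ComposableArrows C p) (α : Fin (q + 1) →o Fin (p + 1))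
    (x : F.obj (τ.obj 0)) (s : stdSimplex ℝ (Fin (q + 1))) :
    T.app τ (tmul x (toPlus (affineMap α s))) =
      G.map (τ.map (homOfLE (Fin.le_last (α (Fin.last q)))))
        (T.app (p := q) (α.monotone.functor ⋙ τ)
          (tmul (F.map (τ.map (homOfLE (Fin.zero_le (α 0)))) x) (toPlus s))) :=
  congrArg (fun k => k (tmul x (toPlus s))) (T.natural τ α)

theorem app_eq_mk₀ (τ : ComposableArrows C 0) (x : F.obj (τ.obj 0))
    (s : stdSimplex ℝ (Fin (0 + 1))) : T.app τ (tmul x (toPlus s)) = T.obj (τ.obj 0) x := by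
  obtain ⟨X, rfl⟩ := ComposableArrows.mk₀_surjective τ
  rw [Subsingleton.elim (α := stdSimplex ℝ (Fin 1)) s (stdSimplex.vertex 0)]
  rfl

/-- A face of a simplex arises as a composite functor `α^* τ`, which is not syntactically of the
form `mk₁`; this puts it in that form. -/
theorem app_eq_mk₁ (τ : ComposableArrows C 1) (z : smash (F.obj (τ.obj 0)) (plus (stdSimplex ℝ (Fin 2)))) :
    T.app τ z = T.app (ComposableArrows.mk₁ (τ.map' 0 1)) z := by
  obtain ⟨X, Y, f, rfl⟩ := ComposableArrows.mk₁_surjective τ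
  rfl

/-- The 1-simplex of an identity is degenerate, so its transfer factors through the collapse of `Δ₁`
to a point and is a constant path. -/
theorem app_id (X : C) (x : F.obj X) (s : stdSimplex ℝ (Fin (1 + 1))) :
    T.app (ComposableArrows.mk₁ (𝟙 X)) (tmul x (toPlus s)) = T.obj X x := by
  -- The degeneracy `[1] → [0]`, whose pullback of `mk₀ X` is the identity arrow of `X`.
  let α : Fin (1 + 1) →o Fin (0 + 1) := ⟨fun _ => 0, monotone_const⟩
  have h := T.app_affineMap (ComposableArrows.mk₀ X) α x s
  rw [app_eq_mk₁] at h
  refine Eq.trans (Eq.symm ?_) (h.symm.trans (T.app_eq_mk₀ _ _ _))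
  change G.map (𝟙 X) (T.app (ComposableArrows.mk₁ (𝟙 X)) (tmul (F.map (𝟙 X) x) _)) = _
  rw [G.map_id, F.map_id]
  rfl

theorem app_edge {p : ℕ} (τ : ComposableArrows C p) (α : Fin (1 + 1) →o Fin (p + 1))
    (x : F.obj (τ.obj 0)) (s : I) :
    T.app τ (tmul x (toPlus (edge α s))) =
      G.map (τ.map (homOfLE (Fin.le_last (α 1))))
        (T.app (ComposableArrows.mk₁ (τ.map (homOfLE (α.monotone (Fin.zero_le 1)))))
          (tmul (F.map (τ.map (homOfLE (Fin.zero_le (α 0)))) x)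
            (toPlus (stdSimplexHomeomorphUnitInterval.symm s)))) := by
  have h := T.app_affineMap τ α x (stdSimplexHomeomorphUnitInterval.symm s)
  rw [app_eq_mk₁] at h
  exact h

variable {X₀ X₁ X₂ : C} (f : X₀ ⟶ X₁) (g : X₁ ⟶ X₂) (x : F.obj X₀) (s : I)

/-- The three faces of a 2-simplex. A face missing the last vertex is pushed forward along `g`, one
missing the first vertex is restricted along `f`, and the face missing the middle vertex sees only
the composite. -/
theorem app_edge01 :
    T.app (ComposableArrows.mk₂ f g) (tmul x (toPlus (edge (edgeMap 0 1 (by decide)) s))) =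
      G.map g (T.app (ComposableArrows.mk₁ f)
        (tmul x (toPlus (stdSimplexHomeomorphUnitInterval.symm s)))) := by
  refine (T.app_edge (ComposableArrows.mk₂ f g) _ x s).trans ?_
  change G.map g (T.app (ComposableArrows.mk₁ f) (tmul (F.map (𝟙 X₀) x) _)) = _
  rw [F.map_id]
  rfl

theorem app_edge12 :
    T.app (ComposableArrows.mk₂ f g) (tmul x (toPlus (edge (edgeMap 1 2 (by decide)) s))) =
      T.app (ComposableArrows.mk₁ g)
        (tmul (F.map f x) (toPlus (stdSimplexHomeomorphUnitInterval.symm s))) := by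
  refine (T.app_edge (ComposableArrows.mk₂ f g) _ x s).trans ?_
  change G.map (𝟙 X₂) (T.app (ComposableArrows.mk₁ g) (tmul (F.map f x) _)) = _
  rw [G.map_id]
  rfl

theorem app_edge02 :
    T.app (ComposableArrows.mk₂ f g) (tmul x (toPlus (edge (edgeMap 0 2 (by decide)) s))) =
      T.app (ComposableArrows.mk₁ (f ≫ g))
        (tmul x (toPlus (stdSimplexHomeomorphUnitInterval.symm s))) := by
  refine (T.app_edge (ComposableArrows.mk₂ f g) _ x s).trans ?_
  change G.map (𝟙 X₂) (T.app (ComposableArrows.mk₁ (f ≫ g)) (tmul (F.map (𝟙 X₀) x) _)) = _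
  rw [G.map_id, F.map_id]
  rfl

theorem app_mk₁_zero :
    T.app (ComposableArrows.mk₁ f)
      (tmul x (toPlus (stdSimplexHomeomorphUnitInterval.symm 0))) = G.map f (T.obj X₀ x) :=
  (T.path f).apply_zero x

theorem app_mk₁_one :
    T.app (ComposableArrows.mk₁ f)
      (tmul x (toPlus (stdSimplexHomeomorphUnitInterval.symm 1))) = T.obj X₁ (F.map f x) :=
  (T.path f).apply_one x
end SimplTrans

/-! ### Consequences of multiplicativity -/

/-- The inclusion `E → E × X` at a point of `X`. -/
def Bdl.inclAt (E : Bdl) (P : CPair) (p : P) : E ⟶ E.prod P where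
  base := { toFun := ⟨fun x => (x, p), by fun_prop⟩, mapsTo := fun _ h => Or.inl h }
  tot := ⟨fun e => (e, p), by fun_prop⟩
  proj_tot _ := rfl
  smooth := by
    rintro φ hφ _ ⟨ψ, hψ, rfl⟩ b hb hb'
    exact (E.compat φ hφ ψ hψ b hb hb').incl

/-- The inclusion of a point in an interval. -/
def CPair.constI (j : I) : CPair.point ⟶ CPair.abs I := ⟨ContinuousMap.const Unit j, fun _ h => h.elim⟩

/-- The vertex of `L(*)`. -/
noncomputable def baseVertex : LFun.obj CPair.point := lmk (P := CPair.point) (vertex ())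

/-- The restriction to end points is essential: for `0 < t < 1` the point `ι(t)` lies inside the
1-cell of the identity simplex of `I`, whereas the inclusion of `t` sends the vertex of `L(*)` to
the 0-cell of `t`. -/
theorem LFun_map_constI {j : I} (hj : j = 0 ∨ j = 1) :
    LFun.map (CPair.constI j) baseVertex = iota (toPlus j) := by
  have h : LFun.map (CPair.constI j) baseVertex = lmk (P := CPair.abs I) (vertex j) :=
    congrArg lmk (realMap_vertex (CPair.constI j).toFun ())
  rw [h]
  rcases hj with rfl | rfl
  · exact congrArg (lmk (P := CPair.abs I)) intervalMap_zero.symm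
  · exact congrArg (lmk (P := CPair.abs I)) intervalMap_one.symm

namespace MultHomotopy
variable {M : MultFunctor} {T : SimplTrans LBase (FTot M)} (μ : MultHomotopy M T)
  {E E' : Bdl} {P Q : CPair}

/-- The arrow of products of bundles and pairs. -/
abbrev arrow (f : E ⟶ E') (g : P ⟶ Q) : (E, P) ⟶ (E', Q) := Prod.mkHom f g

theorem obj_zero (x : LBase.obj E) (y : LFun.obj P) :
    μ.μ.obj (E, P) (tmul (tmul x y) (toPlus (0 : I))) =
      M.ω (Bdl.totFun.obj E) P (tmul (T.obj E x) y) := by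
  refine (μ.zero (ComposableArrows.mk₀ (E, P)) x y (stdSimplex.vertex 0)).trans ?_
  change M.ω _ _ (tmul _ (LFun.map (𝟙 P) y)) = _
  rw [LFun.map_id]
  exact congrArg (fun w => M.ω (Bdl.totFun.obj E) P (tmul w y)) (T.app_eq_mk₀ _ _ _)

theorem obj_one (x : LBase.obj E) (y : LFun.obj P) :
    μ.μ.obj (E, P) (tmul (tmul x y) (toPlus (1 : I))) =
      T.obj (E.prod P) (ωL E.base P (tmul x y)) :=
  (μ.one (ComposableArrows.mk₀ (E, P)) x y (stdSimplex.vertex 0)).trans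
    (T.app_eq_mk₀ _ _ _)

/-- For `μ` on a product arrow, the second factor at this end is only moved along `g`; the simplex
parameter enters through `T` of the first factor alone. -/
theorem arrow_zero (f : E ⟶ E') (g : P ⟶ Q) (x : LBase.obj E) (y : LFun.obj P)
    (s : stdSimplex ℝ (Fin (1 + 1))) :
    μ.μ.app (ComposableArrows.mk₁ (arrow f g)) (tmul (tmul (tmul x y) (toPlus (0 : I))) (toPlus s)) =
      M.ω (Bdl.totFun.obj E') Q
        (tmul (T.app (ComposableArrows.mk₁ f) (tmul x (toPlus s))) (LFun.map g y)) := by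
  refine (μ.zero (ComposableArrows.mk₁ (arrow f g)) x y s).trans ?_
  rw [T.app_eq_mk₁]
  rfl

theorem arrow_one (f : E ⟶ E') (g : P ⟶ Q) (x : LBase.obj E) (y : LFun.obj P)
    (s : stdSimplex ℝ (Fin (1 + 1))) :
    μ.μ.app (ComposableArrows.mk₁ (arrow f g)) (tmul (tmul (tmul x y) (toPlus (1 : I))) (toPlus s)) =
      T.app (ComposableArrows.mk₁ (Bdl.prodFun.map (arrow f g)))
        (tmul (ωL E.base P (tmul x y)) (toPlus s)) := by
  refine (μ.one (ComposableArrows.mk₁ (arrow f g)) x y s).trans ?_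
  rw [T.app_eq_mk₁]
  rfl

/-- Supplies the side condition of `normal` on simplices with second components `*`. -/
theorem point_sub {n : ℕ} (τ : ComposableArrows (Bdl × CPair) n)
    (h : ∀ i, (τ.obj i).2 = CPair.point) (i) :
    (τ.obj i).2.sub = ∅ ∧ Nonempty (Unique (τ.obj i).2) := by
  rw [h i]
  exact ⟨rfl, ⟨inferInstanceAs (Unique Unit)⟩⟩

/-- The multiplicative structure identifies `T(f × *)` with `T(f)`, for an arrow `f`. -/
theorem app_prod_point (μ : MultHomotopy M T) (f : E ⟶ E') (x : LBase.obj E) (s : stdSimplex ℝ (Fin (1 + 1))) :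
    M.F.map (CPair.fst (Bdl.totFun.obj E'))
      (T.app (ComposableArrows.mk₁ (Bdl.prodFun.map (arrow f (𝟙 CPair.point))))
        (tmul (ωL E.base CPair.point (tmul x baseVertex)) (toPlus s))) =
      T.app (ComposableArrows.mk₁ f) (tmul x (toPlus s)) := by
  -- Comparison of the two ends of the constant homotopy: the end 0 is `ω_F(T(f) ∧ v)`, the end 1 is
  -- `T(f × *) ω_L`. The projection of the former is `T(f)` by the unit axiom.
  have h := μ.normal (ComposableArrows.mk₁ (arrow f (𝟙 CPair.point)))
    (point_sub _ (fun i => by fin_cases i <;> rfl)) x baseVertex s 0 1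
  rw [arrow_zero, arrow_one, LFun.map_id] at h
  rw [← h]
  exact M.unit (Bdl.totFun.obj E') _

/-- The multiplicative structure identifies `T(E × *)` with `T(E)`. -/
theorem obj_prod_point (μ : MultHomotopy M T) (x : LBase.obj E) :
    M.F.map (CPair.fst (Bdl.totFun.obj E))
      (T.obj (E.prod CPair.point) (ωL E.base CPair.point (tmul x baseVertex))) = T.obj E x := by
  -- The object case is the case of the identity arrow, where both transfers are constant paths; the
  -- choice of the vertex 0 is immaterial.
  have h := μ.app_prod_point (𝟙 E) x (stdSimplex.vertex 0)
  have e : Bdl.prodFun.map (arrow (𝟙 E) (𝟙 CPair.point)) = 𝟙 (E.prod CPair.point) :=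
    Bdl.prodFun.map_id (E, CPair.point)
  rw [e, T.app_id] at h
  refine Eq.trans (congrArg _ ?_) h
  exact (T.app_id (E.prod CPair.point) _ _).symm

theorem obj_point_const (x : LBase.obj E) (y : LFun.obj CPair.point) (u : I) :
    μ.μ.obj (E, CPair.point) (tmul (tmul x y) (toPlus u)) =
      μ.μ.obj (E, CPair.point) (tmul (tmul x y) (toPlus 0)) :=
  μ.normal (ComposableArrows.mk₀ (E, CPair.point))
    (point_sub _ (fun i => by fin_cases i; rfl)) x y (stdSimplex.vertex 0) u 0

end MultHomotopy
end RefinedTransfer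
/-! ### Transfers and homotopies -/
namespace RefinedTransfer
open scoped unitInterval

/-- The inclusion `E × * → E × I` at the parameter `j`. -/
noncomputable def Bdl.pointIncl (E : Bdl) (j : I) : E.prod CPair.point ⟶ E.prod (CPair.abs I) :=
  Bdl.prodFun.map (MultHomotopy.arrow (𝟙 E) (CPair.constI j))

/-- The composite `D → E' → E' × *` of an arrow with the inclusion. -/
def Bdl.thenPoint {D E' : Bdl} (H : D ⟶ E') : D ⟶ E'.prod CPair.point :=
  H ≫ E'.inclAt CPair.point ()

/-- This is why the factor `*` is kept in the target: the long edge of the 2-simplex becomes a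
product with the identity of `*`, to which `app_prod_point` applies. -/
theorem Bdl.pointIncl_thenPoint {E E' : Bdl} (H : E.prod (CPair.abs I) ⟶ E') (j : I) :
    E.pointIncl j ≫ Bdl.thenPoint H =
      Bdl.prodFun.map (MultHomotopy.arrow (E.incl j ≫ H) (𝟙 CPair.point)) :=
  Bdl.Hom.ext (CPair.hom_ext fun _ => rfl) (ContinuousMap.ext fun _ => rfl)

/-- By the unit axiom for `L`, in the form of `ω_vertex`, the inclusion at the point of `*` acts as
pairing with the vertex. -/
theorem LBase_map_thenPoint {D E' : Bdl} (H : D ⟶ E') (z : LBase.obj D) :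
    LBase.map (Bdl.thenPoint H) z = ωL E'.base CPair.point (tmul (LBase.map H z) baseVertex) := by
  have h := LMult.ω_vertex E'.base CPair.point (LBase.map H z) () rfl
    (Bdl.baseFun.map (E'.inclAt CPair.point ())) (fun _ => rfl)
  refine Eq.trans ?_ h.symm
  rw [Bdl.thenPoint, LBase.map_comp]
  rfl

/-- Naturality of `ω_L` in the second variable, together with the identification of the vertex over
`j` with `ι(j)`. -/
theorem LBase_map_pointIncl (E : Bdl) {j : I} (hj : j = 0 ∨ j = 1) (x : LBase.obj E) :
    LBase.map (E.pointIncl j) (ωL E.base CPair.point (tmul x baseVertex)) =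
      ωL E.base (CPair.abs I) (tmul x (iota (toPlus j))) := by
  have h := congrArg (fun k => k (tmul x baseVertex))
    (LMult.natural (P := E.base) (𝟙 E.base) (CPair.constI j))
  refine Eq.trans h ?_
  change ωL E.base (CPair.abs I)
    (tmul (LFun.map (𝟙 E.base) x) (LFun.map (CPair.constI j) baseVertex)) = _
  rw [LFun_map_constI hj, LFun.map_id]
  rfl

namespace MultFunctor
variable (M : MultFunctor)

/-- The projection away from `*` is a left inverse of the inclusion `E' → E' × *` already at the
level of pairs. -/
theorem fst_thenPoint {D E' : Bdl} (H : D ⟶ E') (z : (FTot M).obj D) :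
    M.F.map (CPair.fst (Bdl.totFun.obj E')) ((FTot M).map (Bdl.thenPoint H) z) =
      (FTot M).map H z := by
  change (M.F.map (Bdl.totFun.map (Bdl.thenPoint H)) ≫ M.F.map (CPair.fst (Bdl.totFun.obj E'))) z = _
  have e : Bdl.totFun.map (Bdl.thenPoint H) ≫ CPair.fst (Bdl.totFun.obj E') = Bdl.totFun.map H :=
    CPair.hom_ext fun _ => rfl
  have h := M.F.map_comp (Bdl.totFun.map (Bdl.thenPoint H)) (CPair.fst (Bdl.totFun.obj E'))
  rw [e] at h
  exact congrArg (fun k => k z) h.symm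

/-- At an end point `ι(j)` is a vertex, so `ω_vertex` applies. -/
theorem ω_iota (P : CPair) {j : I} (hj : j = 0 ∨ j = 1) (x : M.F.obj P) :
    M.ω P (CPair.abs I) (tmul x (iota (toPlus j))) = M.F.map (P.incl j) x := by
  have h : iota (toPlus j) = lmk (P := CPair.abs I) (vertex j) := by
    rcases hj with rfl | rfl
    · exact congrArg (lmk (P := CPair.abs I)) intervalMap_zero
    · exact congrArg (lmk (P := CPair.abs I)) intervalMap_one
  rw [h]
  exact M.ω_vertex P (CPair.abs I) x j rfl (P.incl j) (fun _ => rfl)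
end MultFunctor

/-! ### The fillers of the prism and their edges. -/

namespace MultHomotopy
variable {M : MultFunctor} {T : SimplTrans LBase (FTot M)} (μ : MultHomotopy M T)
  {E E' : Bdl} (H : E.prod (CPair.abs I) ⟶ E')

/-- The projection `F(E' × *) → F(E')`. -/
noncomputable def unproj (M : MultFunctor) (E' : Bdl) :
    (FTot M).obj (E'.prod CPair.point) ⟶ (FTot M).obj E' :=
  M.F.map (CPair.fst (Bdl.totFun.obj E'))

/-- The pointed map `x ↦ x ∧ y`. -/
def tmulRight {X Y : PtSpace} (y : Y) : X ⟶ smash X Y where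
  toFun := ⟨fun x => tmul x y, continuous_from_compactlyGeneratedSpace _ fun _ _ _ _ _ hg =>
    continuous_smk hg continuous_const⟩
  map_pt := tmul_eq_pt _ _ (Or.inl rfl)

theorem continuous_toPlus {K : Type} [TopologicalSpace K] [CompactSpace K] [T2Space K] :
    Continuous (toPlus : K → plus K) := continuous_inl

/-- The homotopy `μ` on the bundle `E` and the interval, as a square in the space of maps. -/
noncomputable def homotopySquare : C(I × I, LBase.obj E ⟶ (FTot M).obj E') :=
  ptFamily (fun z => tmulRight (Y := LFun.obj (CPair.abs I)) (iota (toPlus z.1)) ≫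
      tmulRight (Y := plus I) (toPlus z.2) ≫ μ.μ.obj (E, CPair.abs I) ≫ (FTot M).map H)
    fun _ _ _ _ _ _ ha hb => (PtSpace.continuous (μ.μ.obj (E, CPair.abs I) ≫ (FTot M).map H)).comp
      (continuous_smk (X := smash (LBase.obj E) (LFun.obj (CPair.abs I))) (Y := plus I)
        (continuous_smk (X := LBase.obj E) (Y := LFun.obj (CPair.abs I)) ha
          ((PtSpace.continuous iota).comp (continuous_toPlus.comp (continuous_fst.comp hb))))
        (continuous_toPlus.comp (continuous_snd.comp hb)))

/-- The homotopy `μ` on the inclusion of a point in the interval. -/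
noncomputable def endSquare (j : I) : C(I × I, LBase.obj E ⟶ (FTot M).obj E') :=
  ptFamily (fun z => tmulRight (Y := LFun.obj CPair.point) baseVertex ≫
      tmulRight (Y := plus I) (toPlus z.2) ≫
      tmulRight (Y := plus (stdSimplex ℝ (Fin 2)))
        (toPlus (stdSimplexHomeomorphUnitInterval.symm z.1)) ≫
      μ.μ.app (ComposableArrows.mk₁ (arrow (𝟙 E) (CPair.constI j))) ≫ (FTot M).map H)
    fun _ _ _ _ _ _ ha hb => (PtSpace.continuous
        (μ.μ.app (ComposableArrows.mk₁ (arrow (𝟙 E) (CPair.constI j))) ≫ (FTot M).map H)).comp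
      (continuous_smk (X := smash (smash (LBase.obj E) (LFun.obj CPair.point)) (plus I))
        (Y := plus (stdSimplex ℝ (Fin 2)))
        (continuous_smk (X := smash (LBase.obj E) (LFun.obj CPair.point)) (Y := plus I)
          (continuous_smk (X := LBase.obj E) (Y := LFun.obj CPair.point) ha continuous_const)
          (continuous_toPlus.comp (continuous_snd.comp hb)))
        (continuous_toPlus.comp
          (stdSimplexHomeomorphUnitInterval.symm.continuous.comp (continuous_fst.comp hb))))

/-- The transformation `T` on the arrow `E × I → E' × *`. -/
noncomputable def arrowSquare (T : SimplTrans LBase (FTot M)) :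
    C(I × I, LBase.obj E ⟶ (FTot M).obj E') :=
  ptFamily (fun z => tmulRight (Y := LFun.obj (CPair.abs I)) (iota (toPlus z.1)) ≫
      ωL E.base (CPair.abs I) ≫ tmulRight (Y := plus (stdSimplex ℝ (Fin 2)))
        (toPlus (stdSimplexHomeomorphUnitInterval.symm z.2)) ≫
      T.app (ComposableArrows.mk₁ (Bdl.thenPoint H)) ≫ unproj M E')
    fun _ _ _ _ _ _ ha hb => (PtSpace.continuous
        (T.app (ComposableArrows.mk₁ (Bdl.thenPoint H)) ≫ unproj M E')).comp
      (continuous_smk (X := LObj (E.base.prod (CPair.abs I))) (Y := plus (stdSimplex ℝ (Fin 2)))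
        ((PtSpace.continuous (ωL E.base (CPair.abs I))).comp
          (continuous_smk (X := LBase.obj E) (Y := LFun.obj (CPair.abs I)) ha
            ((PtSpace.continuous iota).comp (continuous_toPlus.comp (continuous_fst.comp hb)))))
        (continuous_toPlus.comp
          (stdSimplexHomeomorphUnitInterval.symm.continuous.comp (continuous_snd.comp hb))))

/-- The transformation `T` on the 2-simplex `E × * → E × I → E' × *`. -/
noncomputable def endTriangle (T : SimplTrans LBase (FTot M)) (j : I) :
    C(stdSimplex ℝ (Fin (2 + 1)), LBase.obj E ⟶ (FTot M).obj E') :=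
  ptFamily (fun w => tmulRight (Y := LFun.obj CPair.point) baseVertex ≫ ωL E.base CPair.point ≫
      tmulRight (Y := plus (stdSimplex ℝ (Fin (2 + 1)))) (toPlus w) ≫
      T.app (ComposableArrows.mk₂ (E.pointIncl j) (Bdl.thenPoint H)) ≫ unproj M E')
    fun _ _ _ _ _ _ ha hb => (PtSpace.continuous
        (T.app (ComposableArrows.mk₂ (E.pointIncl j) (Bdl.thenPoint H)) ≫ unproj M E')).comp
      (continuous_smk (X := LObj (E.base.prod CPair.point))
        (Y := plus (stdSimplex ℝ (Fin (2 + 1))))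
        ((PtSpace.continuous (ωL E.base CPair.point)).comp
          (continuous_smk (X := LBase.obj E) (Y := LFun.obj CPair.point) ha continuous_const))
        (continuous_toPlus.comp hb))

/-- The long edge is the transfer of `h_j × *`, which restricts and projects to the path of `h_j`.
-/
theorem endTriangle_edge02 (μ : MultHomotopy M T) (j s : I) :
    endTriangle H T j (edge (edgeMap 0 2 (by decide)) s) = (T.path (E.incl j ≫ H)).toPath s := by
  apply PtSpace.hom_ext
  intro x
  refine Eq.trans (congrArg (unproj M E') (T.app_edge02 (E.pointIncl j) (Bdl.thenPoint H)
    (ωL E.base CPair.point (tmul x baseVertex)) s)) ?_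
  rw [Bdl.pointIncl_thenPoint]
  exact μ.app_prod_point (E.incl j ≫ H) x _

/-- The first edge is pushed forward to `E' × *` and projected, which amounts to `F(H)`. What
remains is `T` of the product arrow `E × * → E × I`, the end 1 of `μ` on that arrow. -/
theorem endTriangle_edge01 (j s : I) :
    endTriangle H T j (edge (edgeMap 0 1 (by decide)) s) = μ.endSquare H j (s, 1) := by
  apply PtSpace.hom_ext
  intro x
  refine Eq.trans (congrArg (unproj M E') (T.app_edge01 (E.pointIncl j) (Bdl.thenPoint H)
    (ωL E.base CPair.point (tmul x baseVertex)) s)) ?_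
  refine (M.fst_thenPoint H _).trans ?_
  exact congrArg ((FTot M).map H) (μ.arrow_one (𝟙 E) (CPair.constI j) x baseVertex
    (stdSimplexHomeomorphUnitInterval.symm s)).symm

/-- The last edge is the transfer of `E × I → E' × *` restricted along `E × * → E × I`; on `ω_L(x ∧
v)` this restriction gives `ω_L(x ∧ ι(j))`. -/
theorem endTriangle_edge12 {j : I} (hj : j = 0 ∨ j = 1) (s : I) :
    endTriangle H T j (edge (edgeMap 1 2 (by decide)) s) = arrowSquare H T (j, s) := by
  apply PtSpace.hom_ext
  intro x
  refine Eq.trans (congrArg (unproj M E') (T.app_edge12 (E.pointIncl j) (Bdl.thenPoint H)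
    (ωL E.base CPair.point (tmul x baseVertex)) s)) ?_
  rw [LBase_map_pointIncl E hj x]
  rfl

/-- At the end 0 the homotopy `μ` involves the bundle only through `T` of the identity of `E`, a
constant path; pairing with `ι(j)` is then the inclusion at `j`. -/
theorem endSquare_bottom {j : I} (hj : j = 0 ∨ j = 1) (s : I) :
    μ.endSquare H j (s, 0) = T.obj E ≫ (FTot M).map (E.incl j ≫ H) := by
  apply PtSpace.hom_ext
  intro x
  refine Eq.trans (congrArg ((FTot M).map H) (μ.arrow_zero (𝟙 E) (CPair.constI j) x baseVertex
    (stdSimplexHomeomorphUnitInterval.symm s))) ?_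
  rw [T.app_id, LFun_map_constI hj, (FTot M).map_comp]
  exact congrArg ((FTot M).map H) (M.ω_iota (Bdl.totFun.obj E) hj (T.obj E x))

/-- At the first vertex of the arrow only `μ` on `(E, *)` is left, and this is constant in the
homotopy parameter. -/
theorem endSquare_left {j : I} (hj : j = 0 ∨ j = 1) (u : I) :
    μ.endSquare H j (0, u) = T.obj E ≫ (FTot M).map (E.incl j ≫ H) := by
  -- The constant value need not be computed again: the left side is compared with its own lower
  -- corner.
  rw [← μ.endSquare_bottom H hj 0]
  apply PtSpace.hom_ext
  intro x
  have h : ∀ u : I, μ.endSquare H j (0, u) x = (FTot M).map H ((Bdl.prodFun ⋙ FTot M).map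
      (arrow (𝟙 E) (CPair.constI j)) (μ.μ.obj (E, CPair.point)
        (tmul (X := smash (LBase.obj E) (LFun.obj CPair.point)) (Y := plus I)
          (tmul x baseVertex) (toPlus u)))) := fun u =>
    congrArg ((FTot M).map H) (μ.μ.app_mk₁_zero (arrow (𝟙 E) (CPair.constI j)) _)
  rw [h, h]
  exact congrArg (fun w => (FTot M).map H ((Bdl.prodFun ⋙ FTot M).map
      (arrow (𝟙 E) (CPair.constI j)) w)) (μ.obj_point_const x baseVertex u)

/-- At the last vertex of the arrow there remains `μ` on `(E, I)`, evaluated at the image of the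
vertex of `L(*)`, which is `ι(j)`. -/
theorem endSquare_right {j : I} (hj : j = 0 ∨ j = 1) (u : I) :
    μ.endSquare H j (1, u) = μ.homotopySquare H (j, u) := by
  apply PtSpace.hom_ext
  intro x
  refine Eq.trans (congrArg ((FTot M).map H)
    (μ.μ.app_mk₁_one (arrow (𝟙 E) (CPair.constI j)) _)) ?_
  change (FTot M).map H (μ.μ.obj (E, CPair.abs I)
    (tmul (X := smash (LBase.obj E) (LFun.obj (CPair.abs I))) (Y := plus I)
      (tmul (LBase.map (𝟙 E) x) (LFun.map (CPair.constI j) baseVertex)) (toPlus u))) = _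
  rw [LFun_map_constI hj, LBase.map_id]
  rfl

/-- Valid for all `t`, since the path induced by `H` is itself defined through `ω_F` and `ι`. -/
theorem homotopySquare_bottom (t : I) : μ.homotopySquare H (t, 0) =
    ((M.hat (P := Bdl.totFun.obj E) (Bdl.totFun.map H)).precomp (T.obj E)).toPath t := by
  apply PtSpace.hom_ext
  intro x
  exact congrArg ((FTot M).map H)
    (μ.obj_zero (E := E) (P := CPair.abs I) x (iota (toPlus t)))

/-- Both sides are `F(H) T(E × I) ω_L(x ∧ ι(t))`: the end 1 of `μ`, and the start of the path of the
arrow `E × I → E' × *` after projection. -/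
theorem homotopySquare_top (t : I) : μ.homotopySquare H (t, 1) = arrowSquare H T (t, 0) := by
  apply PtSpace.hom_ext
  intro x
  refine Eq.trans (congrArg ((FTot M).map H)
    (μ.obj_one (E := E) (P := CPair.abs I) x (iota (toPlus t)))) (Eq.symm ?_)
  exact (congrArg (unproj M E') (T.app_mk₁_zero (Bdl.thenPoint H) _)).trans (M.fst_thenPoint H _)

/-- At its end the path of the arrow is `T(E' × *)` applied to `ω_L(z ∧ v)`, with `z` the value of
the path induced by `H` on `L`. By `obj_prod_point` its projection is `T(E')` of `z`. -/
theorem arrowSquare_top (μ : MultHomotopy M T) (t : I) : arrowSquare H T (t, 1) =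
    ((LMult.hat (P := E.base) (Bdl.baseFun.map H)).postcomp (T.obj E')).toPath t := by
  apply PtSpace.hom_ext
  intro x
  refine (congrArg (unproj M E') (T.app_mk₁_one (Bdl.thenPoint H) _)).trans ?_
  exact (congrArg (fun z => unproj M E' (T.obj (E'.prod CPair.point) z))
    (LBase_map_thenPoint H _)).trans (μ.obj_prod_point _)

end MultHomotopy
end RefinedTransfer

/-! ### The theorem: assembling the prism. -/

open RefinedTransfer
theorem mainTheorem5 (F : MultFunctor) (T : SimplTrans LBase (FTot F)) (μ : MultHomotopy F T)
    {E E' : Bdl} (H : E.prod (CPair.abs unitInterval) ⟶ E') :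
    MapPath.SameClass
      ((T.path (E.incl 0 ≫ H)).trans
        ((LMult.hat (P := E.base) (Bdl.baseFun.map H)).postcomp (T.obj E')))
      (((F.hat (P := Bdl.totFun.obj E) (Bdl.totFun.map H)).precomp (T.obj E)).trans
        (T.path (E.incl 1 ≫ H))) := by
  apply MapPath.sameClass_trans
  -- The vertical paths `l j` are the transfers of `h_j`. The edge conditions involving `ι(j)` hold
  -- only for `j` equal to 0 or 1, which is why `prism_homotopic` asks for no more at the ends.
  exact prism_homotopic
    (a := fun j => T.obj E ≫ (FTot F).map (E.incl j ≫ H))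
    (e := fun j => LBase.map (E.incl j ≫ H) ≫ T.obj E')
    ((F.hat (P := Bdl.totFun.obj E) (Bdl.totFun.map H)).precomp (T.obj E)).toPath
    ((LMult.hat (P := E.base) (Bdl.baseFun.map H)).postcomp (T.obj E')).toPath
    (fun j => (T.path (E.incl j ≫ H)).toPath)
    (MultHomotopy.endTriangle H T) (μ.endSquare H) (μ.homotopySquare H)
    (MultHomotopy.arrowSquare H T)
    (fun j _ => μ.endTriangle_edge02 H j) (fun j _ => μ.endTriangle_edge01 H j)
    (fun _ hj => MultHomotopy.endTriangle_edge12 H hj)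
    (fun _ hj => μ.endSquare_bottom H hj) (fun _ hj => μ.endSquare_left H hj)
    (fun _ hj => μ.endSquare_right H hj) (μ.homotopySquare_bottom H) (μ.homotopySquare_top H)
    (μ.arrowSquare_top H)
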